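/- Equip $\mathbb{R}^d$ with its Euclidean norm. For a locally Lipschitz function $h\colon\mathbb{R}^d\to\mathbb{R}$, let $\partial h(x)$ be the Clarke subdifferential, i.e. the convex hull of all limits $\lim_i\nabla h(x_i)$ with $x_i\to x$ and $h$ differentiable at every $x_i$. For a closed set $\mathcal X\subseteq\mathbb{R}^d$ and $x\in\mathcal X$, let $N^P_{\mathcal X}(x)=\{\lambda v:\lambda\ge 0,\ x\in\mathrm{proj}_{\mathcal X}(x+v)\}$ be the proximal normal cone, let $N^L_{\mathcal X}(x)$ be the set of all limits of $v_i\in N^P_{\mathcal X}(x_i)$ with $x_i\in\mathcal X$, $x_i\to x$, and let $N_{\mathcal X}(x)=\mathrm{cl}\,\mathrm{conv}\,N^L_{\mathcal X}(x)$ be the Clarke normal cone. An arc is an absolutely continuous curve $z\colon[0,\infty)\to\mathbb{R}^d$, i.e. $z(t)=z(0)+\int_0^t y(\tau)\,d\tau$ for all $t\ge0$, for some $y$ that is integrable on compact intervals. Let $f,g\colon\mathbb{R}^d\to\mathbb{R}$ and $\mathcal X\subseteq\mathbb{R}^d$, and put $\varphi=f+g$. A point $x\in\mathcal X$ is composite critical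 if $0\in\partial f(x)+\partial g(x)+N_{\mathcal X}(x)$; a real $r$ is a composite critical value if $r=\varphi(x)$ for some composite critical $x$. Let $P$ be a probability measure on a measurable space $\Omega$, let $\zeta\colon\mathbb{R}^d\times\Omega\to\mathbb{R}^d$ be measurable, and let $T\colon(0,\infty)\times\mathbb{R}^d\to\mathbb{R}^d$ be measurable with $$T_\alpha(z)\in\operatorname*{argmin}_{x\in\mathcal X}\Big\{g(x)+\tfrac1{2\alpha}\|x-z\|^2\Big\}\qquad\text{for all }\alpha>0,\ z\in\mathbb{R}^d.$$ Let $\alpha_k>0$ $(k\ge1)$, let $\omega_1,\omega_2,\dots$ be i.i.d. with law $P$, let $x_1$ be a (possibly random) point, almost surely in $\mathcal X$ and independent of $(\omega_k)_{k\ge1}$, and let $$x_{k+1}=T_{\alpha_k}\big(x_k-\alpha_k\zeta(x_k,\omega_k)\big),\qquad k\ge1 .$$ Assume: 1. $\mathcal X$ is closed, $f$ and $g$ are locally Lipschitz, and $g$ is bounded from below on $\mathcal X$. 2. There is a function $L\colon\mathbb{R}^d\to\mathbb{R}$, bounded on bounded sets, such that $L(x)\ge\frac{g(x)-g(z)}{\|x-z\|}$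 for all $x$ and all $z\ne x$ with $g(z)\le g(x)$. 3. $\sum_k\alpha_k=\infty$ and $\sum_k\alpha_k^2<\infty$. 4. Almost surely, $\sup_k\|x_k\|<\infty$. 5. There is a function $p\colon\mathbb{R}^d\to[0,\infty)$, bounded on bounded sets, such that $\mathbb{E}_\omega[\zeta(x,\omega)]\in\partial f(x)$ and $\mathbb{E}_\omega[\|\zeta(x,\omega)\|^2]\le p(x)$ for all $x\in\mathcal X$. 6. For every convergent sequence $\{z_k\}$ in $\mathbb{R}^d$, $\mathbb{E}_\omega[\sup_k\|\zeta(z_k,\omega)\|]<\infty$. 7. (Weak Sard) The set of real numbers that are not composite critical values is dense in $\mathbb{R}$. 8. (Descent) Whenever $z$ is an arc with $z(t)\in\mathcal X$ for all $t\ge0$ and $\dot z(t)\in-\big(\partial f(z(t))+\partial g(z(t))+N_{\mathcal X}(z(t))\big)$ for a.e. $t\ge0$, and $z(0)$ is not composite critical, there is $T>0$ with $$\varphi(z(T))<\sup_{t\in[0,T]}\varphi(z(t))\le\varphi(z(0)).$$ Then almost surely every limit point of $\{x_k\}$ is composite critical, that is, lies in $\mathcal X$ and satisfies $0\in\partial f(x)+\partial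 g(x)+N_{\mathcal X}(x)$, and the sequence $\{\varphi(x_k)\}$ converges (to a finite limit). -/

import Mathlib

open Set Filter Topology MeasureTheory ProbabilityTheory
open scoped Pointwise ENNReal

section Variational

variable {E : Type*} [NormedAddCommGroup E] [InnerProductSpace ℝ E]

/-- Limits `lim ∇f(xᵢ)` along sequences `xᵢ → x` of points at which `f` is differentiable. -/
def limitingGradients [CompleteSpace E] (f : E → ℝ) (x : E) : Set E :=
  {v | ∃ u : ℕ → E, (∀ i, DifferentiableAt ℝ f (u i)) ∧ Tendsto u atTop (𝓝 x) ∧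
    Tendsto (fun i => gradient f (u i)) atTop (𝓝 v)}

/-- The Clarke subdifferential of a (locally Lipschitz) function: the convex hull of the
limiting gradients. -/
def clarkeSubdiff [CompleteSpace E] (f : E → ℝ) (x : E) : Set E :=
  convexHull ℝ (limitingGradients f x)

/-- The (set-valued) nearest point map of `X`. -/
def projSet (X : Set E) (z : E) : Set E :=
  {y | y ∈ X ∧ ∀ w ∈ X, ‖z - y‖ ≤ ‖z - w‖}

/-- The proximal normal cone `{l v : x ∈ proj_X (x + v), l ≥ 0}`. -/
def proximalNormalCone (X : Set E) (x : E) : Set E :=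
  {n | ∃ (l : ℝ) (v : E), 0 ≤ l ∧ x ∈ projSet X (x + v) ∧ n = l • v}

/-- The limiting normal cone. -/
def limitingNormalCone (X : Set E) (x : E) : Set E :=
  {v | ∃ (u n : ℕ → E), (∀ i, u i ∈ X) ∧ (∀ i, n i ∈ proximalNormalCone X (u i)) ∧
    Tendsto u atTop (𝓝 x) ∧ Tendsto n atTop (𝓝 v)}

/-- The Clarke normal cone: the closed convex hull of the limiting normal cone. -/
def clarkeNormalCone (X : Set E) (x : E) : Set E :=
  closure (convexHull ℝ (limitingNormalCone X x))

/-- The set-valued map `G(x) = -∂f(x) - ∂g(x) - N_X(x)`. -/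
def compositeField [CompleteSpace E] (f g : E → ℝ) (X : Set E) (x : E) : Set E :=
  -(clarkeSubdiff f x + clarkeSubdiff g x + clarkeNormalCone X x)

/-- `x` is composite critical for `min_{x ∈ X} f(x) + g(x)`. -/
def IsCompositeCritical [CompleteSpace E] (f g : E → ℝ) (X : Set E) (x : E) : Prop :=
  x ∈ X ∧ (0 : E) ∈ clarkeSubdiff f x + clarkeSubdiff g x + clarkeNormalCone X x

/-- The composite critical values. -/
def compositeCriticalValues [CompleteSpace E] (f g : E → ℝ) (X : Set E) : Set ℝ :=
  {r | ∃ x, IsCompositeCritical f g X x ∧ f x + g x = r}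

/-- An arc, that is, an absolutely continuous curve on `[0, ∞)`; the values of `z` at negative
times play no role. -/
def IsArc (z : ℝ → E) : Prop :=
  ∃ y : ℝ → E, (∀ t, 0 ≤ t → IntervalIntegrable y volume 0 t) ∧
    ∀ t, 0 ≤ t → z t = z 0 + ∫ s in (0 : ℝ)..t, y s

/-- `z` is an arc in `X` with `z'(t) ∈ G(z(t))` for almost every `t ≥ 0`. -/
def IsTrajectory (G : E → Set E) (X : Set E) (z : ℝ → E) : Prop :=
  IsArc z ∧ (∀ t, 0 ≤ t → z t ∈ X) ∧
    ∀ᵐ t ∂(volume.restrict (Ici (0 : ℝ))), deriv z t ∈ G (z t)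

/-- The composite weak Sard property: the noncritical values are dense in `ℝ`. -/
def CompositeWeakSard [CompleteSpace E] (f g : E → ℝ) (X : Set E) : Prop :=
  Dense (compositeCriticalValues f g X)ᶜ

/-- The composite descent property: `φ = f + g` eventually strictly decreases along every
trajectory that starts at a point which is not composite critical. -/
def CompositeDescent [CompleteSpace E] (f g : E → ℝ) (X : Set E) : Prop :=
  ∀ z : ℝ → E, IsTrajectory (compositeField f g X) X z → ¬ IsCompositeCritical f g X (z 0) →
    ∃ T : ℝ, 0 < T ∧
      f (z T) + g (z T) < sSup ((fun t => f (z t) + g (z t)) '' Icc 0 T) ∧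
      sSup ((fun t => f (z t) + g (z t)) '' Icc 0 T) ≤ f (z 0) + g (z 0)

/-- A real function that is bounded on bounded sets. -/
def BoundedOnBounded (h : E → ℝ) : Prop :=
  ∀ s : Set E, Bornology.IsBounded s → Bornology.IsBounded (h '' s)

/-- The growth condition on `g`: there is `L`, bounded on bounded sets, with
`L(x) ≥ (g(x) - g(z)) / ‖x - z‖` for all `z ≠ x` with `g(z) ≤ g(x)`. -/
def GrowthCondition (g : E → ℝ) : Prop :=
  ∃ L : E → ℝ, BoundedOnBounded L ∧
    ∀ x z : E, z ≠ x → g z ≤ g x → (g x - g z) / ‖x - z‖ ≤ L x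

/-- A measurable selection of the proximal map
`(α, z) ↦ argmin_{x ∈ X} g(x) + ‖x - z‖² / (2α)` on `(0, ∞) × E`. -/
structure IsProxSelection [MeasurableSpace E] (g : E → ℝ) (X : Set E) (T : ℝ → E → E) :
    Prop where
  measurable : Measurable (fun q : Ioi (0 : ℝ) × E => T q.1 q.2)
  mem : ∀ α : ℝ, 0 < α → ∀ z, T α z ∈ X
  isMin : ∀ α : ℝ, 0 < α → ∀ z, ∀ x ∈ X,
    g (T α z) + 1 / (2 * α) * ‖T α z - z‖ ^ 2 ≤ g x + 1 / (2 * α) * ‖x - z‖ ^ 2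

/-- A stochastic subgradient oracle for `f`, with its moment bound on `X` and its local
integrability. -/
structure IsSubgradientOracle [CompleteSpace E] [MeasurableSpace E] {Ω : Type*}
    [MeasurableSpace Ω] (P : Measure Ω) (f : E → ℝ) (X : Set E) (ζ : E → Ω → E) : Prop where
  measurable : Measurable (fun q : E × Ω => ζ q.1 q.2)
  mean_mem : ∀ x ∈ X, ∫ ω, ζ x ω ∂P ∈ clarkeSubdiff f x
  moment : ∃ p : E → ℝ, (∀ x, 0 ≤ p x) ∧ BoundedOnBounded p ∧
    ∀ x ∈ X, ∫⁻ ω, ‖ζ x ω‖ₑ ^ 2 ∂P ≤ ENNReal.ofReal (p x)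
  locallyIntegrable : ∀ (z : ℕ → E) (z' : E), Tendsto z atTop (𝓝 z') →
    ∫⁻ ω, ⨆ k, ‖ζ (z k) ω‖ₑ ∂P < ∞

/-- The iterates of the proximal stochastic subgradient method, started at the (possibly random)
point `x₀` and driven by the samples `ω k`. -/
def proxSubgradIter {Ω S : Type*} (T : ℝ → E → E) (ζ : E → Ω → E) (α : ℕ → ℝ)
    (x₀ : S → E) (ω : ℕ → S → Ω) : ℕ → S → E
  | 0 => x₀
  | k + 1 => fun s =>
      T (α k) (proxSubgradIter T ζ α x₀ ω k s - α k • ζ (proxSubgradIter T ζ α x₀ ω k s) (ω k s))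

end Variational

/-! One step of the method is `x (k+1) = x k - α k • D k`, where `D k` is `proxDisplacement`. Split
`D k` into its mean over the sample, `meanDisplacement`, and a centred remainder. The method is then
a discretisation of `z' ∈ G(z)` with `G = compositeField f g X`, perturbed by noise.

The noise is harmless: on bounded sets the growth condition and the moment bound give uniform second
moments, so `∑ α k • ξ k` is, after truncation, an L²-bounded martingale and converges
(`ae_exists_tendsto_noise`).

The drift is asymptotically in `G`. For a fixed sample, `D - ζ` is the scaled displacement of a
proximal step, and its limits lie in `∂g + N_X` (`mem_of_tendsto_proximal_displacement`). Separation
and dominated convergence carry this through the expectation, while `E ζ ∈ ∂f` passes to the limit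
by closedness of the graph (`neg_mem_compositeField_of_tendsto`).

Hence time-shifted iterates converge, along any ultrafilter at infinity, to a trajectory of `G`
(`exists_limit_trajectory`). If `φ` oscillated, weak Sard would supply a noncritical level `a`
upcrossed infinitely often. A limit of the upcrossings is a trajectory starting at height `a`;
descent keeps it at or below `a` and takes it strictly below, contradicting the upcrossing. Once `φ
(x k)` converges, `φ` is constant on every limit trajectory, so by descent none starts at a
noncritical point. -/

/-! ### Compactness of convex hulls (Carathéodory). -/

section ConvexHull

variable {E : Type*} [NormedAddCommGroup E] [NormedSpace ℝ E] [FiniteDimensional ℝ E]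

/-- In a finite-dimensional space the convex hull of a compact set is compact. -/
theorem isCompact_convexHull_of_isCompact {K : Set E} (hK : IsCompact K) :
    IsCompact (convexHull ℝ K) := by
  rcases K.eq_empty_or_nonempty with rfl | ⟨k₀, hk₀⟩
  · simp
  set n := Module.finrank ℝ E + 1 with hn
  have hcomp : IsCompact ((fun q : (Fin n → ℝ) × (Fin n → E) => ∑ i, q.1 i • q.2 i) ''
      (stdSimplex ℝ (Fin n) ×ˢ Set.pi univ fun _ => K)) := by
    refine ((isCompact_stdSimplex ℝ (Fin n)).prod (isCompact_univ_pi fun _ => hK)).image ?_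
    fun_prop
  convert hcomp using 1
  apply Subset.antisymm
  · intro x hx
    -- Carathéodory: affinely independent points number at most `finrank + 1`. Unused slots are
    -- padded with weight `0` at the point `k₀`.
    obtain ⟨ι, _, z, w, hz, hind, hw, hw1, hx⟩ := eq_pos_convex_span_of_mem_convexHull hx
    have hcard : Fintype.card ι ≤ Fintype.card (Fin n) := by
      simpa [hn] using (hind.card_le_finrank_succ.trans
        (Nat.succ_le_succ (Submodule.finrank_le _)))
    obtain ⟨e⟩ := Function.Embedding.nonempty_of_card_le hcard
    refine ⟨(Function.extend e w 0, Function.extend e z fun _ => k₀), ⟨⟨fun i => ?_, ?_⟩, ?_⟩, ?_⟩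
    · by_cases hi : ∃ a, e a = i
      · obtain ⟨a, rfl⟩ := hi
        simpa [e.injective.extend_apply] using (hw a).le
      · simp [Function.extend_apply' _ _ _ hi]
    · rw [← hw1]
      refine (Fintype.sum_of_injective e e.injective _ _ (fun i hi => ?_) fun i => ?_).symm
      · simp [Function.extend_apply' _ _ _ hi]
      · simp [e.injective.extend_apply]
    · intro i _
      by_cases hi : ∃ a, e a = i
      · obtain ⟨a, rfl⟩ := hi
        simpa [e.injective.extend_apply] using hz ⟨a, rfl⟩
      · simpa [Function.extend_apply' _ _ _ hi] using hk₀
    · rw [← hx]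
      refine (Fintype.sum_of_injective e e.injective _ _ (fun i hi => ?_) fun i => ?_).symm
      · simp [Function.extend_apply' _ _ _ hi]
      · simp [e.injective.extend_apply]
  · rintro _ ⟨⟨w, z⟩, ⟨hw, hz⟩, rfl⟩
    exact mem_convexHull_of_exists_fintype w z hw.1 hw.2 (fun i => hz i trivial) rfl

end ConvexHull

/-! ### Growth of Lipschitz functions along segments. -/

section LineIntegral

variable {E : Type*} [NormedAddCommGroup E] [InnerProductSpace ℝ E] [FiniteDimensional ℝ E]

/-- A Lipschitz function whose derivative in the direction `e` is at most `c` at every point of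
differentiability of a ball grows at most at rate `c` along `e` inside that ball. -/
theorem LipschitzWith.sub_le_of_fderiv_le {h : E → ℝ} {K : NNReal} (hh : LipschitzWith K h)
    {u e : E} {r c : ℝ}
    (hc : ∀ y ∈ Metric.ball u r, DifferentiableAt ℝ h y → fderiv ℝ h y e ≤ c)
    {t : ℝ} (ht : 0 ≤ t) (htr : t * ‖e‖ < r) : h (u + t • e) - h u ≤ c * t := by
  borelize E
  let ν : Measure E := Measure.addHaar
  have hdiff : ∀ᵐ y ∂ν, DifferentiableAt ℝ h y := hh.ae_differentiableAt
  have hmeas : MeasurableSet {q : ℝ × E | DifferentiableAt ℝ h (q.2 + q.1 • e)} :=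
    (measurableSet_of_differentiableAt ℝ h).preimage
      (f := fun q : ℝ × E => q.2 + q.1 • e) (by fun_prop)
  -- Rademacher says nothing about the one line through `u`. By Fubini almost every parallel line
  -- meets the non-differentiability set in a null set; the bound is proved on those lines and
  -- reaches `u` by density and continuity.
  have hae : ∀ᵐ y ∂ν, ∀ᵐ s : ℝ, DifferentiableAt ℝ h (y + s • e) := by
    refine (Measure.ae_ae_comm (p := fun s y => DifferentiableAt ℝ h (y + s • e)) hmeas).1 ?_
    refine Eventually.of_forall fun s => ?_
    exact (measurePreserving_add_right ν (s • e)).quasiMeasurePreserving.ae hdiff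
  have hdense : Dense {y : E | ∀ᵐ s : ℝ, DifferentiableAt ℝ h (y + s • e)} :=
    Measure.dense_of_ae hae
  -- The reduced radius keeps the whole segment from `y` to `y + t • e` inside `ball u r`.
  have hkey : ∀ y ∈ Metric.ball u (r - t * ‖e‖) ∩
      {y : E | ∀ᵐ s : ℝ, DifferentiableAt ℝ h (y + s • e)}, h (y + t • e) - h y ≤ c * t := by
    rintro y ⟨hy, hys⟩
    have hlip : LipschitzWith (K * ‖e‖₊) (fun s : ℝ => h (y + s • e)) := by
      refine hh.comp (LipschitzWith.of_dist_le_mul fun a b => ?_)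
      simp [dist_eq_norm, ← sub_smul, norm_smul, mul_comm]
    have hac := (hlip.lipschitzOnWith (s := uIcc 0 t)).absolutelyContinuousOnInterval
    have hint := hac.integral_deriv_eq_sub
    simp only [zero_smul, add_zero] at hint
    rw [← hint]
    have : ∫ s in (0 : ℝ)..t, deriv (fun s : ℝ => h (y + s • e)) s ≤ ∫ s in (0 : ℝ)..t, c := by
      refine intervalIntegral.integral_mono_ae_restrict ht hac.intervalIntegrable_deriv
        intervalIntegrable_const ?_
      filter_upwards [ae_restrict_of_ae hys, ae_restrict_mem measurableSet_Icc] with s hs hst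
      have hball : y + s • e ∈ Metric.ball u r := by
        rw [Metric.mem_ball, dist_eq_norm] at hy ⊢
        calc ‖y + s • e - u‖ = ‖(y - u) + s • e‖ := by congr 1; abel
          _ ≤ ‖y - u‖ + |s| * ‖e‖ := (norm_add_le _ _).trans_eq (by rw [norm_smul, Real.norm_eq_abs])
          _ ≤ ‖y - u‖ + t * ‖e‖ := by
              gcongr
              rw [abs_of_nonneg hst.1]; exact hst.2
          _ < r := by linarith
      have h1 : HasDerivAt (fun s : ℝ => y + s • e) e s := by
        simpa using ((hasDerivAt_id s).smul_const e).const_add y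
      have := (hs.hasFDerivAt.comp_hasDerivAt s h1).deriv
      simp only [Function.comp_def] at this
      rw [this]
      exact hc _ hball hs
    simpa [mul_comm] using this
  have hu : u ∈ closure (Metric.ball u (r - t * ‖e‖) ∩
      {y : E | ∀ᵐ s : ℝ, DifferentiableAt ℝ h (y + s • e)}) :=
    hdense.open_subset_closure_inter Metric.isOpen_ball (Metric.mem_ball_self (by linarith))
  have hcont := hh.continuous
  exact closure_minimal (t := {y | h (y + t • e) - h y ≤ c * t}) hkey
    (isClosed_le (by fun_prop) continuous_const) hu

end LineIntegral

/-! ### Clarke subdifferential: compactness, closed graph, proximal subgradients. -/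

section Clarke

variable {E : Type*} [NormedAddCommGroup E] [InnerProductSpace ℝ E] [CompleteSpace E]

theorem norm_gradient_le_of_lipschitzOnWith {g : E → ℝ} {s : Set E} {K : NNReal}
    (hg : LipschitzOnWith K g s) {y : E} (hs : s ∈ 𝓝 y) : ‖gradient g y‖ ≤ K := by
  have := norm_fderiv_le_of_lipschitzOn ℝ hs hg
  rwa [gradient, LinearIsometryEquiv.norm_map]

theorem norm_le_of_mem_limitingGradients {g : E → ℝ} {s : Set E} {K : NNReal}
    (hg : LipschitzOnWith K g s) {y : E} (hs : s ∈ 𝓝 y) {v : E} (hv : v ∈ limitingGradients g y) :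
    ‖v‖ ≤ K := by
  obtain ⟨u, -, hu, huv⟩ := hv
  refine le_of_tendsto huv.norm ?_
  filter_upwards [hu.eventually (eventually_mem_nhds_iff.2 hs)] with i hi
  exact norm_gradient_le_of_lipschitzOnWith hg hi

theorem norm_le_of_mem_clarkeSubdiff {g : E → ℝ} {s : Set E} {K : NNReal}
    (hg : LipschitzOnWith K g s) {y : E} (hs : s ∈ 𝓝 y) {v : E} (hv : v ∈ clarkeSubdiff g y) :
    ‖v‖ ≤ K := by
  have : clarkeSubdiff g y ⊆ Metric.closedBall 0 K :=
    convexHull_min (fun w hw => by simpa using norm_le_of_mem_limitingGradients hg hs hw)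
      (convex_closedBall _ _)
  simpa using this hv

theorem isClosed_limitingGradients (g : E → ℝ) (x : E) : IsClosed (limitingGradients g x) := by
  refine IsSeqClosed.isClosed fun v w hv hvw => ?_
  choose u hd hu hgr using hv
  have hex : ∀ n, ∃ i, dist (u n i) x < 1 / (n + 1 : ℝ) ∧
      dist (gradient g (u n i)) (v n) < 1 / (n + 1 : ℝ) := fun n =>
    ((hu n).eventually (Metric.ball_mem_nhds x Nat.one_div_pos_of_nat) |>.and
      ((hgr n).eventually (Metric.ball_mem_nhds (v n) Nat.one_div_pos_of_nat))).exists
  choose i hi1 hi2 using hex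
  refine ⟨fun n => u n (i n), fun n => hd n _, ?_, ?_⟩
  · rw [tendsto_iff_dist_tendsto_zero]
    exact squeeze_zero (fun _ => dist_nonneg) (fun n => (hi1 n).le)
      tendsto_one_div_add_atTop_nhds_zero_nat
  · refine (tendsto_iff_of_dist (f₁ := v) ?_).1 hvw
    refine squeeze_zero (fun _ => dist_nonneg) (fun n => ?_)
      tendsto_one_div_add_atTop_nhds_zero_nat
    rw [dist_comm]
    exact (hi2 n).le

variable [FiniteDimensional ℝ E]

theorem LocallyLipschitz.isCompact_limitingGradients {g : E → ℝ} (hg : LocallyLipschitz g) (x : E) :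
    IsCompact (limitingGradients g x) := by
  obtain ⟨K, s, hs, hK⟩ := hg x
  have := FiniteDimensional.proper_real E
  exact (isCompact_closedBall (0 : E) K).of_isClosed_subset (isClosed_limitingGradients g x)
    fun v hv => by simpa using norm_le_of_mem_limitingGradients hK hs hv

theorem LocallyLipschitz.isCompact_clarkeSubdiff {g : E → ℝ} (hg : LocallyLipschitz g) (x : E) :
    IsCompact (clarkeSubdiff g x) :=
  isCompact_convexHull_of_isCompact (hg.isCompact_limitingGradients x)

/-- A strict bound on the limiting gradients in a direction persists for nearby gradients. -/
theorem LocallyLipschitz.eventually_inner_gradient_lt {g : E → ℝ} (hg : LocallyLipschitz g)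
    {x e : E} {c : ℝ} (h : ∀ a ∈ limitingGradients g x, inner ℝ a e < c) :
    ∀ᶠ y in 𝓝 x, DifferentiableAt ℝ g y → inner ℝ (gradient g y) e < c := by
  obtain ⟨K, s, hs, hK⟩ := hg x
  have := FiniteDimensional.proper_real E
  by_contra hcon
  have hfr : ∃ᶠ y in 𝓝 x, DifferentiableAt ℝ g y ∧ c ≤ inner ℝ (gradient g y) e := by
    simpa only [not_eventually, Classical.not_imp, not_lt] using hcon
  obtain ⟨u, hu, hu'⟩ := exists_seq_forall_of_frequently
    (hfr.and_eventually (eventually_mem_nhds_iff.2 hs))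
  obtain ⟨a, -, n, hn, ha⟩ := (isCompact_closedBall (0 : E) K).tendsto_subseq
    (x := fun i => gradient g (u i)) fun i => by
      simpa using norm_gradient_le_of_lipschitzOnWith hK (hu' i).2
  have hlim := h a ⟨u ∘ n, fun i => (hu' _).1.1, hu.comp hn.tendsto_atTop, ha⟩
  exact hlim.not_ge (ge_of_tendsto (ha.inner tendsto_const_nhds)
    (Eventually.of_forall fun i => (hu' _).1.2))

/-- Hahn–Banach separates `v` from the compact convex subdifferential, and a strict bound on
limiting gradients spreads to all gradients near `x`. Inclusions in the subdifferential thus reduce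
to scalar inequalities in one direction `e`. -/
theorem LocallyLipschitz.exists_separation {g : E → ℝ} (hg : LocallyLipschitz g) {x v : E}
    (hv : v ∉ clarkeSubdiff g x) :
    ∃ (e : E) (c : ℝ), c < inner ℝ v e ∧
      ∀ᶠ y in 𝓝 x, DifferentiableAt ℝ g y → inner ℝ (gradient g y) e < c := by
  obtain ⟨φ, c, hφ, hc⟩ := geometric_hahn_banach_closed_point (convex_convexHull ℝ _)
    (hg.isCompact_clarkeSubdiff x).isClosed hv
  have hin : ∀ a, inner ℝ a ((InnerProductSpace.toDual ℝ E).symm φ) = φ a := fun a => by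
    rw [real_inner_comm, InnerProductSpace.toDual_symm_apply]
  refine ⟨(InnerProductSpace.toDual ℝ E).symm φ, c, by rwa [hin], ?_⟩
  exact hg.eventually_inner_gradient_lt fun a ha => by
    rw [hin]
    exact hφ a (subset_convexHull ℝ _ ha)

/-- The Clarke subdifferential of a locally Lipschitz function has a closed graph. -/
theorem LocallyLipschitz.mem_clarkeSubdiff_of_tendsto {g : E → ℝ} (hg : LocallyLipschitz g)
    {x v : E} {y w : ℕ → E} (hy : Tendsto y atTop (𝓝 x)) (hw : Tendsto w atTop (𝓝 v))
    (hyw : ∀ i, w i ∈ clarkeSubdiff g (y i)) : v ∈ clarkeSubdiff g x := by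
  by_contra hv
  obtain ⟨e, c, hc, hev⟩ := hg.exists_separation hv
  refine hc.not_ge (le_of_tendsto (hw.inner (tendsto_const_nhds (x := e))) ?_)
  filter_upwards [hy.eventually (eventually_eventually_nhds.2 hev)] with i hi
  have hconv : Convex ℝ {a : E | inner ℝ a e ≤ c} :=
    convex_halfSpace_le (f := fun a => inner ℝ a e) ⟨fun a b => by
      simp [inner_add_left], fun r a => by
      simp [inner_smul_left]⟩ c
  refine convexHull_min (fun a ha => ?_) hconv (hyw i)
  obtain ⟨u, hd, hu, hgr⟩ := ha
  change inner ℝ a e ≤ c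
  refine le_of_tendsto (hgr.inner (tendsto_const_nhds (x := e))) ?_
  filter_upwards [hu.eventually hi] with j hj
  exact (hj (hd j)).le

/-- A proximal subgradient of a locally Lipschitz function is a Clarke subgradient. -/
theorem LocallyLipschitz.mem_clarkeSubdiff_of_proximal {g : E → ℝ} (hg : LocallyLipschitz g)
    {u v : E} {σ : ℝ} (h : ∀ᶠ y in 𝓝 u, g u + inner ℝ v (y - u) - σ * ‖y - u‖ ^ 2 ≤ g y) :
    v ∈ clarkeSubdiff g u := by
  by_contra hv
  obtain ⟨e, c, hc, hev⟩ := hg.exists_separation hv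
  obtain ⟨K, s, hs, hK⟩ := hg u
  obtain ⟨r, hr, hball⟩ := Metric.mem_nhds_iff.1 (inter_mem hs hev)
  -- The segment bound is stated for globally Lipschitz functions, so `g` is replaced by an
  -- extension that agrees with it on the ball.
  obtain ⟨k, hk, hgk⟩ := (hK.mono fun y hy => (hball hy).1).extend_real
  have heq : ∀ y ∈ Metric.ball u r, g =ᶠ[𝓝 y] k := fun y hy => by
    filter_upwards [Metric.isOpen_ball.mem_nhds hy] with z hz using hgk hz
  have hlin : ∀ t : ℝ, 0 ≤ t → t * ‖e‖ < r → k (u + t • e) - k u ≤ c * t := fun t ht htr => by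
    refine hk.sub_le_of_fderiv_le (r := r) (fun y hy hd => ?_) ht htr
    rw [← (heq y hy).fderiv_eq, ← inner_gradient_left]
    exact ((hball hy).2 ((heq y hy).differentiableAt_iff.2 hd)).le
  have hline : Tendsto (fun t : ℝ => u + t • e) (𝓝[>] 0) (𝓝 u) := by
    have : ContinuousAt (fun t : ℝ => u + t • e) 0 := by fun_prop
    simpa [ContinuousAt] using this.tendsto.mono_left (nhdsWithin_le_nhds (s := Ioi (0 : ℝ)))
  have hσ : Tendsto (fun t : ℝ => c + σ * t * ‖e‖ ^ 2) (𝓝[>] 0) (𝓝 c) := by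
    have : ContinuousAt (fun t : ℝ => c + σ * t * ‖e‖ ^ 2) 0 := by fun_prop
    simpa [ContinuousAt] using this.tendsto.mono_left (nhdsWithin_le_nhds (s := Ioi (0 : ℝ)))
  -- Along `u + t • e` the growth of `g` is at least `t⟪v, e⟫ - σ t² ‖e‖²` and at most `c t`.
  -- Dividing by `t` and letting `t → 0` gives `⟪v, e⟫ ≤ c`, against the separation.
  refine hc.not_ge (ge_of_tendsto hσ ?_)
  filter_upwards [hline.eventually h, hline.eventually (Metric.ball_mem_nhds u hr),
    self_mem_nhdsWithin] with t h1 h2 (h3 : 0 < t)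
  have h4 : t * ‖e‖ < r := by
    simpa [dist_eq_norm, norm_smul, abs_of_pos h3] using h2
  have h5 := hlin t h3.le h4
  rw [← hgk h2, ← hgk (Metric.mem_ball_self hr)] at h5
  simp only [add_sub_cancel_left, inner_smul_right, norm_smul, Real.norm_eq_abs, mul_pow,
    sq_abs] at h1
  have h6 : t * inner ℝ v e ≤ t * (c + σ * t * ‖e‖ ^ 2) := by linarith
  exact le_of_mul_le_mul_left h6 h3

end Clarke

/-! ### Optimality conditions for proximal steps, by penalisation. -/

section Optimality

variable {E : Type*} [NormedAddCommGroup E] [InnerProductSpace ℝ E]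

theorem norm_sub_sq_expand (y u a : E) :
    ‖y - a‖ ^ 2 = ‖u - a‖ ^ 2 + 2 * inner ℝ (u - a) (y - u) + ‖y - u‖ ^ 2 := by
  rw [← norm_add_sq_real]
  congr 2
  abel

variable [FiniteDimensional ℝ E]

/-- The penalised minimisers of a constrained problem come arbitrarily close to its solution. -/
theorem exists_penalized_minimizer {h : E → ℝ} (hh : Continuous h) {X : Set E} (hX : IsClosed X)
    {x : E} (hx : x ∈ X) (hmin : ∀ w ∈ X, h x ≤ h w) {δ : ℝ} (hδ : 0 < δ) :
    ∃ (u : E) (j : ℕ), dist u x < δ ∧ ∀ y ∈ Metric.closedBall x 1,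
      h u + ‖u - x‖ ^ 2 + j * Metric.infDist u X ^ 2 ≤
        h y + ‖y - x‖ ^ 2 + j * Metric.infDist y X ^ 2 := by
  have := FiniteDimensional.proper_real E
  have hne : X.Nonempty := ⟨x, hx⟩
  have hinf : Continuous fun y => Metric.infDist y X := Metric.continuous_infDist_pt X
  have hball := isCompact_closedBall x (1 : ℝ)
  have hbn : (Metric.closedBall x (1 : ℝ)).Nonempty := ⟨x, by simp⟩
  have hmem : ∀ j : ℕ, ∃ u ∈ Metric.closedBall x (1 : ℝ), ∀ y ∈ Metric.closedBall x 1,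
      h u + ‖u - x‖ ^ 2 + j * Metric.infDist u X ^ 2 ≤
        h y + ‖y - x‖ ^ 2 + j * Metric.infDist y X ^ 2 := fun j =>
    hball.exists_isMinOn hbn (f := fun y => h y + ‖y - x‖ ^ 2 + j * Metric.infDist y X ^ 2)
      (by fun_prop)
  choose u hu humin using hmem
  obtain ⟨b, -, hb⟩ := hball.exists_isMinOn hbn hh.continuousOn
  have hle : ∀ j, h (u j) + ‖u j - x‖ ^ 2 + j * Metric.infDist (u j) X ^ 2 ≤ h x := fun j => by
    have := humin j x (by simp)
    simpa [Metric.infDist_zero_of_mem hx] using this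
  obtain ⟨a, -, n, hn, ha⟩ := hball.tendsto_subseq hu
  -- The penalty is at most `h x - min h` over the ball, so the squared distance to `X` is `O(1 / n
  -- i)`.
  have hzero : Tendsto (fun i => Metric.infDist (u (n i)) X ^ 2) atTop (𝓝 0) := by
    have hlim : Tendsto (fun i => (h x - h b) / (n i : ℝ)) atTop (𝓝 0) :=
      tendsto_const_nhds.div_atTop (tendsto_natCast_atTop_atTop.comp hn.tendsto_atTop)
    refine squeeze_zero' (Eventually.of_forall fun _ => by positivity) ?_ hlim
    filter_upwards [eventually_gt_atTop 0] with i hi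
    have hni : (0 : ℝ) < n i := by exact_mod_cast hi.trans_le (hn.id_le i)
    rw [le_div_iff₀ hni]
    have h1 := hle (n i)
    have h2 : h b ≤ h (u (n i)) := hb (hu (n i))
    nlinarith [sq_nonneg ‖u (n i) - x‖]
  have haX : a ∈ X := by
    rw [hX.mem_iff_infDist_zero hne]
    have := tendsto_nhds_unique (((hinf.tendsto a).comp ha).pow 2) hzero
    simpa using this
  -- The minimiser `x` need not be unique; the added term `‖y - x‖ ^ 2` singles it out.
  have hax : a = x := by
    have h1 : h a + ‖a - x‖ ^ 2 ≤ h x := by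
      have hc : Continuous fun y => h y + ‖y - x‖ ^ 2 := by fun_prop
      refine le_of_tendsto ((hc.tendsto a).comp ha) (Eventually.of_forall fun i => ?_)
      have := hle (n i)
      have : 0 ≤ (n i : ℝ) * Metric.infDist (u (n i)) X ^ 2 := by positivity
      simp only [Function.comp_apply]
      linarith
    have h2 := hmin a haX
    have h3 : ‖a - x‖ ^ 2 = 0 := le_antisymm (by linarith) (by positivity)
    simpa [sub_eq_zero] using h3
  subst hax
  obtain ⟨i, hi⟩ := (ha.eventually (Metric.ball_mem_nhds a hδ)).exists
  exact ⟨u (n i), n i, hi, humin (n i)⟩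

variable [CompleteSpace E]

/-- An approximate optimality condition for proximal steps. -/
theorem exists_approximate_optimality {g : E → ℝ} (hg : LocallyLipschitz g) {X : Set E}
    (hX : IsClosed X) {x z : E} {α : ℝ} (hα : 0 < α) (hx : x ∈ X)
    (hmin : ∀ w ∈ X, g x + 1 / (2 * α) * ‖x - z‖ ^ 2 ≤ g w + 1 / (2 * α) * ‖w - z‖ ^ 2)
    {ε : ℝ} (hε : 0 < ε) :
    ∃ u p v n : E, dist u x < ε ∧ dist p x < ε ∧ p ∈ X ∧ v ∈ clarkeSubdiff g u ∧
      n ∈ proximalNormalCone X p ∧ ‖α⁻¹ • (z - x) - v - n‖ ≤ ε := by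
  have := FiniteDimensional.proper_real E
  have hgc := hg.continuous
  -- The three bounds make the residual `(α⁻¹ + 2) • (u - x)` at most `ε`, put `p` (within `2 * dist
  -- u x` of `x`) closer than `ε`, and keep `u` interior to the unit ball on which it is a
  -- minimiser.
  set δ := min (ε / (α⁻¹ + 2)) (min (ε / 2) 1) with hδ
  have hα' : 0 < α⁻¹ + 2 := by positivity
  have hδ0 : 0 < δ := by positivity
  obtain ⟨u, j, hux, humin⟩ := exists_penalized_minimizer
    (h := fun w => g w + 1 / (2 * α) * ‖w - z‖ ^ 2) (by fun_prop) hX hx hmin hδ0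
  obtain ⟨p, hp, hup⟩ := hX.exists_infDist_eq_dist ⟨x, hx⟩ u
  have hpmin : ∀ w ∈ X, ‖u - p‖ ≤ ‖u - w‖ := fun w hw => by
    rw [← dist_eq_norm, ← dist_eq_norm, ← hup]
    exact Metric.infDist_le_dist_of_mem hw
  have hu1 : dist u x < ε / (α⁻¹ + 2) := hux.trans_le (min_le_left _ _)
  have hu2 : dist u x < ε / 2 := hux.trans_le ((min_le_right _ _).trans (min_le_left _ _))
  have hu3 : dist u x < 1 := hux.trans_le ((min_le_right _ _).trans (min_le_right _ _))
  have hpx : dist p x < ε := by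
    have h1 := dist_triangle p u x
    have h2 := hpmin x hx
    rw [← dist_eq_norm, ← dist_eq_norm, dist_comm u p] at h2
    linarith
  -- Replacing `infDist y X` by `‖y - p‖`, with `p` a projection of `u`, majorises the penalty by a
  -- quadratic touching it at `u`. Minus the gradient of all the quadratic terms is then a proximal
  -- subgradient of `g`, with `σ` the sum of their coefficients; the penalty part is a proximal
  -- normal at `p`.
  refine ⟨u, p, -(α⁻¹ • (u - z) + (2 : ℝ) • (u - x) + (2 * j : ℝ) • (u - p)),
    (2 * j : ℝ) • (u - p), by linarith, hpx, hp, ?_, ?_, ?_⟩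
  · refine hg.mem_clarkeSubdiff_of_proximal (σ := 1 / (2 * α) + 1 + j) ?_
    filter_upwards [Metric.isOpen_ball.mem_nhds (Metric.mem_ball.2 hu3)] with y hy
    have h1 := humin y (Metric.ball_subset_closedBall hy)
    have h2 : Metric.infDist y X ^ 2 ≤ ‖y - p‖ ^ 2 := by
      gcongr
      · exact Metric.infDist_nonneg
      · rw [← dist_eq_norm]
        exact Metric.infDist_le_dist_of_mem hp
    have h2' := mul_le_mul_of_nonneg_left h2 (Nat.cast_nonneg (α := ℝ) j)
    rw [hup, dist_eq_norm] at h1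
    rw [norm_sub_sq_expand y u p] at h2'
    rw [norm_sub_sq_expand y u x, norm_sub_sq_expand y u z] at h1
    simp only [inner_neg_left, inner_add_left, real_inner_smul_left]
    have h3 : 1 / (2 * α) * (2 * inner ℝ (u - z) (y - u)) = α⁻¹ * inner ℝ (u - z) (y - u) := by
      field_simp
    nlinarith [h1, h2', h3]
  · exact ⟨2 * j, u - p, by positivity, ⟨hp, by simpa using hpmin⟩, rfl⟩
  · have : α⁻¹ • (z - x) - -(α⁻¹ • (u - z) + (2 : ℝ) • (u - x) + (2 * j : ℝ) • (u - p)) -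
        (2 * j : ℝ) • (u - p) = (α⁻¹ + 2) • (u - x) := by module
    rw [this, norm_smul, Real.norm_of_nonneg hα'.le, ← dist_eq_norm]
    rw [lt_div_iff₀ hα'] at hu1
    linarith

/-- Limits of the scaled displacements of proximal steps. -/
theorem mem_of_tendsto_proximal_displacement {g : E → ℝ} (hg : LocallyLipschitz g) {X : Set E}
    (hX : IsClosed X) {x z : ℕ → E} {α : ℕ → ℝ} (hα : ∀ j, 0 < α j) (hx : ∀ j, x j ∈ X)
    (hmin : ∀ j, ∀ w ∈ X, g (x j) + 1 / (2 * α j) * ‖x j - z j‖ ^ 2 ≤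
      g w + 1 / (2 * α j) * ‖w - z j‖ ^ 2)
    {x' w : E} (hx' : Tendsto x atTop (𝓝 x'))
    (hw : Tendsto (fun j => (α j)⁻¹ • (z j - x j)) atTop (𝓝 w)) :
    w ∈ clarkeSubdiff g x' + clarkeNormalCone X x' := by
  have := FiniteDimensional.proper_real E
  choose u p v n hu hp hpX hv hn hle using fun j : ℕ =>
    exists_approximate_optimality hg hX (hα j) (hx j) (hmin j)
      (ε := 1 / (j + 1 : ℝ)) Nat.one_div_pos_of_nat
  have hz : Tendsto (fun j : ℕ => 1 / (j + 1 : ℝ)) atTop (𝓝 0) :=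
    tendsto_one_div_add_atTop_nhds_zero_nat
  have hlim : ∀ q : ℕ → E, (∀ j : ℕ, dist (q j) (x j) < 1 / (j + 1 : ℝ)) →
      Tendsto q atTop (𝓝 x') := fun q hq => by
    refine (tendsto_iff_of_dist (f₁ := x) ?_).1 hx'
    refine squeeze_zero (fun _ => dist_nonneg) (fun j => ?_) hz
    rw [dist_comm]
    exact (hq j).le
  have hu' := hlim u hu
  have hp' := hlim p hp
  obtain ⟨K, s, hs, hK⟩ := hg x'
  have hbd : ∀ᶠ j in atTop, v j ∈ Metric.closedBall (0 : E) K := by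
    filter_upwards [hu'.eventually (eventually_mem_nhds_iff.2 hs)] with j hj
    simpa using norm_le_of_mem_clarkeSubdiff hK hj (hv j)
  -- Only the subgradients need compactness: the normals then converge to `w - v'`, since the
  -- residuals vanish.
  obtain ⟨v', -, φ, hφ, hv'⟩ :=
    (isCompact_closedBall (0 : E) K).tendsto_subseq' hbd.frequently
  refine ⟨v', hg.mem_clarkeSubdiff_of_tendsto (hu'.comp hφ.tendsto_atTop) hv' fun j => hv _,
    w - v', subset_closure (subset_convexHull ℝ _ ?_), by simp⟩
  refine ⟨p ∘ φ, n ∘ φ, fun _ => hpX _, fun _ => hn _, hp'.comp hφ.tendsto_atTop, ?_⟩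
  refine (tendsto_iff_of_dist (f₁ := fun j => (α (φ j))⁻¹ • (z (φ j) - x (φ j)) - v (φ j)) ?_).1
    ((hw.comp hφ.tendsto_atTop).sub hv')
  refine squeeze_zero (fun _ => dist_nonneg) (fun j => ?_) (hz.comp hφ.tendsto_atTop)
  rw [dist_eq_norm]
  exact hle _

end Optimality

set_option linter.unusedSectionVars false

/-! ### Closedness and convexity of the composite field. -/

section Field

variable {E : Type*} [NormedAddCommGroup E] [InnerProductSpace ℝ E]

theorem BoundedOnBounded.exists_bound {h : E → ℝ} (hh : BoundedOnBounded h) {s : Set E}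
    (hs : Bornology.IsBounded s) : ∃ B : ℝ, 0 ≤ B ∧ ∀ x ∈ s, h x ≤ B := by
  obtain ⟨B, hB⟩ := isBounded_iff_forall_norm_le.1 (hh s hs)
  exact ⟨max B 0, le_max_right _ _, fun x hx =>
    (le_abs_self _).trans ((hB _ (mem_image_of_mem h hx)).trans (le_max_left _ _))⟩

theorem convex_clarkeNormalCone (X : Set E) (x : E) : Convex ℝ (clarkeNormalCone X x) :=
  (convex_convexHull ℝ _).closure

variable [CompleteSpace E] [FiniteDimensional ℝ E]

/-- A compact set plus a closed set is closed; the cone alone offers no compactness. -/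
theorem isClosed_clarkeSubdiff_add_clarkeNormalCone {g : E → ℝ} (hg : LocallyLipschitz g)
    (X : Set E) (x : E) : IsClosed (clarkeSubdiff g x + clarkeNormalCone X x) :=
  isClosed_closure.add_left_of_isCompact (hg.isCompact_clarkeSubdiff x)

theorem convex_clarkeSubdiff_add_clarkeNormalCone (g : E → ℝ) (X : Set E) (x : E) :
    Convex ℝ (clarkeSubdiff g x + clarkeNormalCone X x) :=
  (convex_convexHull ℝ _).add (convex_clarkeNormalCone X x)

theorem isClosed_compositeField {f g : E → ℝ} (hf : LocallyLipschitz f) (hg : LocallyLipschitz g)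
    (X : Set E) (x : E) : IsClosed (compositeField f g X x) :=
  (isClosed_closure.add_left_of_isCompact
    ((hf.isCompact_clarkeSubdiff x).add (hg.isCompact_clarkeSubdiff x))).neg

theorem convex_compositeField (f g : E → ℝ) (X : Set E) (x : E) :
    Convex ℝ (compositeField f g X x) :=
  (((convex_convexHull ℝ _).add (convex_convexHull ℝ _)).add (convex_clarkeNormalCone X x)).neg

end Field

/-! ### Displacements of the proximal steps: bounds and limits of their means. -/

section Displacement

variable {E : Type*} [NormedAddCommGroup E] [InnerProductSpace ℝ E]
  {Ω : Type*} [MeasurableSpace Ω]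

/-- The scaled displacement of a proximal stochastic subgradient step. -/
noncomputable def proxDisplacement (T : ℝ → E → E) (ζ : E → Ω → E) (a : ℝ) (x : E) (w : Ω) : E :=
  a⁻¹ • (x - T a (x - a • ζ x w))

/-- The expected scaled displacement of a proximal stochastic subgradient step. -/
noncomputable def meanDisplacement (P : Measure Ω) (T : ℝ → E → E) (ζ : E → Ω → E) (a : ℝ)
    (x : E) : E :=
  ∫ w, proxDisplacement T ζ a x w ∂P

theorem proxStep_eq_sub_smul_displacement (T : ℝ → E → E) (ζ : E → Ω → E) {a : ℝ} (ha : 0 < a)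
    (x : E) (w : Ω) :
    T a (x - a • ζ x w) = x - a • proxDisplacement T ζ a x w := by
  rw [proxDisplacement, smul_inv_smul₀ ha.ne']
  abel

variable [MeasurableSpace E]

/-- Testing the minimality of `p` against `x` gives `‖x - p‖² / (2a) ≤ g x - g p + ⟪x - p, c⟫`. The
growth condition bounds `g x - g p` by `B ‖x - p‖` wherever `p` lies, so a factor `‖x - p‖` cancels.
-/
theorem IsProxSelection.norm_sub_le {g : E → ℝ} {X : Set E} {T : ℝ → E → E}
    (hT : IsProxSelection g X T) {L : E → ℝ}
    (hL : ∀ x z : E, z ≠ x → g z ≤ g x → (g x - g z) / ‖x - z‖ ≤ L x) {B : ℝ} (hB : 0 ≤ B)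
    {x : E} (hx : x ∈ X) (hLB : L x ≤ B) {a : ℝ} (ha : 0 < a) (c : E) :
    ‖x - T a (x - a • c)‖ ≤ a * (2 * (B + ‖c‖)) := by
  set p := T a (x - a • c) with hp
  rcases eq_or_ne p x with h | hpx
  · simp only [h, sub_self, norm_zero]
    positivity
  have hpos : 0 < ‖x - p‖ := norm_pos_iff.2 (sub_ne_zero.2 hpx.symm)
  have h1 := hT.isMin a ha (x - a • c) x hx
  rw [← hp] at h1
  have h2 : ‖p - (x - a • c)‖ ^ 2 = ‖x - p‖ ^ 2 - 2 * (a * inner ℝ (x - p) c) +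
      ‖x - (x - a • c)‖ ^ 2 := by
    have : p - (x - a • c) = a • c - (x - p) := by abel
    rw [this, norm_sub_sq_real, sub_sub_cancel, real_inner_smul_left, real_inner_comm]
    ring
  have h3 : g x - g p ≤ B * ‖x - p‖ := by
    rcases le_or_gt (g p) (g x) with h | h
    · have := (hL x p hpx h).trans hLB
      rwa [div_le_iff₀ hpos] at this
    · have : 0 ≤ B * ‖x - p‖ := by positivity
      linarith
  have h4 : inner ℝ (x - p) c ≤ ‖x - p‖ * ‖c‖ := real_inner_le_norm _ _
  rw [h2] at h1
  have h5 : 1 / (2 * a) * ‖x - p‖ ^ 2 ≤ (B + ‖c‖) * ‖x - p‖ := by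
    have : 1 / (2 * a) * (2 * (a * inner ℝ (x - p) c)) = inner ℝ (x - p) c := by field_simp
    nlinarith
  have h6 : ‖x - p‖ ^ 2 ≤ a * (2 * (B + ‖c‖)) * ‖x - p‖ := by
    have := mul_le_mul_of_nonneg_left h5 (by positivity : 0 ≤ 2 * a)
    rw [← mul_assoc, mul_one_div_cancel (by positivity), one_mul] at this
    linarith
  rw [sq] at h6
  exact le_of_mul_le_mul_right h6 hpos

theorem IsProxSelection.norm_displacement_le {g : E → ℝ} {X : Set E} {T : ℝ → E → E}
    (hT : IsProxSelection g X T) {L : E → ℝ}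
    (hL : ∀ x z : E, z ≠ x → g z ≤ g x → (g x - g z) / ‖x - z‖ ≤ L x) {B : ℝ} (hB : 0 ≤ B)
    {x : E} (hx : x ∈ X) (hLB : L x ≤ B) {a : ℝ} (ha : 0 < a) (ζ : E → Ω → E) (w : Ω) :
    ‖proxDisplacement T ζ a x w‖ ≤ 2 * (B + ‖ζ x w‖) := by
  rw [proxDisplacement, norm_smul, norm_inv, Real.norm_of_nonneg ha.le, inv_mul_le_iff₀ ha]
  exact hT.norm_sub_le hL hB hx hLB ha _

variable [BorelSpace E] [FiniteDimensional ℝ E]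

theorem IsProxSelection.measurable_apply {g : E → ℝ} {X : Set E} {T : ℝ → E → E}
    (hT : IsProxSelection g X T) {a : ℝ} (ha : 0 < a) : Measurable (T a) :=
  hT.measurable.comp (measurable_prodMk_left (x := (⟨a, ha⟩ : Ioi (0 : ℝ))))

theorem IsProxSelection.measurable_proxDisplacement {g : E → ℝ} {X : Set E} {T : ℝ → E → E}
    (hT : IsProxSelection g X T) {ζ : E → Ω → E} (hζ : Measurable fun q : E × Ω => ζ q.1 q.2)
    {a : ℝ} (ha : 0 < a) : Measurable fun q : E × Ω => proxDisplacement T ζ a q.1 q.2 := by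
  have := FiniteDimensional.proper_real E
  exact (measurable_fst.sub
    ((hT.measurable_apply ha).comp (measurable_fst.sub (hζ.const_smul a)))).const_smul a⁻¹

variable [CompleteSpace E]

theorem IsSubgradientOracle.measurable_apply {P : Measure Ω} {f : E → ℝ} {X : Set E}
    {ζ : E → Ω → E} (hζ : IsSubgradientOracle P f X ζ) (x : E) : Measurable (ζ x) :=
  hζ.measurable.comp measurable_prodMk_left

/-- A pointwise second moment bound in terms of Bochner integrals. -/
theorem integrable_sq_of_lintegral_le {P : Measure Ω} {c : Ω → E} (hc : Measurable c) {b : ℝ}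
    (hb : 0 ≤ b) (h : ∫⁻ w, ‖c w‖ₑ ^ 2 ∂P ≤ ENNReal.ofReal b) :
    Integrable (fun w => ‖c w‖ ^ 2) P ∧ ∫ w, ‖c w‖ ^ 2 ∂P ≤ b := by
  have := FiniteDimensional.proper_real E
  have heq : ∀ w, ENNReal.ofReal (‖c w‖ ^ 2) = ‖c w‖ₑ ^ 2 := fun w => by
    rw [ENNReal.ofReal_pow (norm_nonneg _), ofReal_norm]
  have hm : AEStronglyMeasurable (fun w => ‖c w‖ ^ 2) P :=
    (hc.norm.pow_const 2).aestronglyMeasurable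
  constructor
  · refine ⟨hm, ?_⟩
    rw [hasFiniteIntegral_iff_ofReal (Eventually.of_forall fun w => by positivity)]
    simp only [heq]
    exact h.trans_lt ENNReal.ofReal_lt_top
  · rw [integral_eq_lintegral_of_nonneg_ae (Eventually.of_forall fun w => by positivity) hm]
    simp only [heq]
    exact ENNReal.toReal_le_of_le_ofReal hb h

variable {P : Measure Ω} [IsProbabilityMeasure P] {f g : E → ℝ} {X : Set E} {ζ : E → Ω → E}
  {T : ℝ → E → E}

theorem IsSubgradientOracle.integrable (hζ : IsSubgradientOracle P f X ζ) {x : E} (hx : x ∈ X) :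
    Integrable (ζ x) P := by
  obtain ⟨p, hp0, -, hp⟩ := hζ.moment
  have := FiniteDimensional.proper_real E
  have h := (integrable_sq_of_lintegral_le (hζ.measurable_apply x) (hp0 x) (hp x hx)).1
  refine ((integrable_const (1 : ℝ)).add h).mono' (hζ.measurable_apply x).aestronglyMeasurable
    (Eventually.of_forall fun w => ?_)
  simp only [Pi.add_apply]
  nlinarith [sq_nonneg (‖ζ x w‖ - 1)]

theorem IsProxSelection.integrable_displacement (hT : IsProxSelection g X T)
    (hgrowth : GrowthCondition g) (hζ : IsSubgradientOracle P f X ζ) {x : E} (hx : x ∈ X)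
    {a : ℝ} (ha : 0 < a) : Integrable (proxDisplacement T ζ a x) P := by
  obtain ⟨L, -, hL⟩ := hgrowth
  have := FiniteDimensional.proper_real E
  refine (((integrable_const (max (L x) 0)).add (hζ.integrable hx).norm).const_mul 2).mono'
    ((hT.measurable_proxDisplacement hζ.measurable ha).comp
      measurable_prodMk_left).aestronglyMeasurable (Eventually.of_forall fun w => ?_)
  exact hT.norm_displacement_le hL (le_max_right _ _) hx (le_max_left _ _) ha ζ w

/-- On a bounded set the displacements have uniformly bounded second moments. -/
theorem IsProxSelection.exists_moment_bound (hT : IsProxSelection g X T)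
    (hgrowth : GrowthCondition g) (hζ : IsSubgradientOracle P f X ζ) {s : Set E}
    (hs : Bornology.IsBounded s) :
    ∃ C : ℝ, 0 ≤ C ∧ ∀ x ∈ s, x ∈ X → ∀ a, 0 < a →
      Integrable (fun w => ‖proxDisplacement T ζ a x w‖ ^ 2) P ∧
      ∫ w, ‖proxDisplacement T ζ a x w‖ ^ 2 ∂P ≤ C := by
  obtain ⟨L, hLb, hL⟩ := hgrowth
  obtain ⟨p, hp0, hpb, hp⟩ := hζ.moment
  obtain ⟨B, hB, hLB⟩ := hLb.exists_bound hs
  obtain ⟨C, hC, hpC⟩ := hpb.exists_bound hs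
  have := FiniteDimensional.proper_real E
  -- From `(2 (B + t))² ≤ 8 (B² + t²)` with `t = ‖ζ x w‖`.
  refine ⟨8 * (B ^ 2 + C), by positivity, fun x hxs hx a ha => ?_⟩
  obtain ⟨hi, hi'⟩ :=
    integrable_sq_of_lintegral_le (hζ.measurable_apply x) (hp0 x) (hp x hx)
  have hle : ∀ w, ‖proxDisplacement T ζ a x w‖ ^ 2 ≤ 8 * (B ^ 2 + ‖ζ x w‖ ^ 2) := fun w => by
    have h1 := hT.norm_displacement_le hL hB hx (hLB x hxs) ha ζ w
    have h2 : ‖proxDisplacement T ζ a x w‖ ^ 2 ≤ (2 * (B + ‖ζ x w‖)) ^ 2 := by gcongr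
    nlinarith [sq_nonneg (B - ‖ζ x w‖)]
  have hint : Integrable (fun w => 8 * (B ^ 2 + ‖ζ x w‖ ^ 2)) P :=
    ((integrable_const _).add hi).const_mul 8
  have hm : Measurable (proxDisplacement T ζ a x) :=
    (hT.measurable_proxDisplacement hζ.measurable ha).comp measurable_prodMk_left
  have hint' : Integrable (fun w => ‖proxDisplacement T ζ a x w‖ ^ 2) P :=
    hint.mono' (hm.norm.pow_const 2).aestronglyMeasurable (Eventually.of_forall fun w => by
      rw [Real.norm_of_nonneg (by positivity)]
      exact hle w)
  refine ⟨hint', (integral_mono hint' hint hle).trans ?_⟩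
  rw [integral_const_mul, integral_add (integrable_const _) hi]
  simp only [integral_const, probReal_univ, one_smul]
  have := hpC x hxs
  linarith

theorem norm_integral_le_one_add_sq {c : Ω → E} {C : ℝ}
    (hi : Integrable (fun w => ‖c w‖ ^ 2) P) (hC : ∫ w, ‖c w‖ ^ 2 ∂P ≤ C) :
    ‖∫ w, c w ∂P‖ ≤ 1 + C := by
  refine (norm_integral_le_of_norm_le ((integrable_const (1 : ℝ)).add hi)
    (Eventually.of_forall fun w => ?_)).trans ?_
  · simp only [Pi.add_apply]
    nlinarith [sq_nonneg (‖c w‖ - 1)]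
  · simp only [Pi.add_apply]
    rw [integral_add (integrable_const _) hi]
    simpa using hC

/-- On a bounded set the mean displacements are uniformly bounded. -/
theorem IsProxSelection.exists_meanDisplacement_bound (hT : IsProxSelection g X T)
    (hgrowth : GrowthCondition g) (hζ : IsSubgradientOracle P f X ζ) {s : Set E}
    (hs : Bornology.IsBounded s) :
    ∃ C : ℝ, 0 ≤ C ∧ ∀ x ∈ s, x ∈ X → ∀ a, 0 < a → ‖meanDisplacement P T ζ a x‖ ≤ C := by
  obtain ⟨C, hC, h⟩ := hT.exists_moment_bound hgrowth hζ hs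
  exact ⟨1 + C, by positivity, fun x hxs hx a ha =>
    norm_integral_le_one_add_sq (h x hxs hx a ha).1 (h x hxs hx a ha).2⟩

/-- Pointwise, the part of the displacement produced by `g` and `X` is asymptotically on the good
side of every hyperplane that separates from the limiting set. -/
theorem IsProxSelection.tendsto_posPart_of_separation (hT : IsProxSelection g X T)
    (hg : LocallyLipschitz g) (hX : IsClosed X) {L : E → ℝ}
    (hL : ∀ x z : E, z ≠ x → g z ≤ g x → (g x - g z) / ‖x - z‖ ≤ L x) {B : ℝ} (hB : 0 ≤ B)
    {x : ℕ → E} {a : ℕ → ℝ} (hx : ∀ j, x j ∈ X) (hLB : ∀ j, L (x j) ≤ B) (ha : ∀ j, 0 < a j)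
    (ha0 : Tendsto a atTop (𝓝 0)) {x' : E} (hx' : Tendsto x atTop (𝓝 x'))
    {M : ℝ} {w : Ω} (hM : ∀ j, ‖ζ (x j) w‖ ≤ M)
    {φ : E →L[ℝ] ℝ} {c : ℝ} (hφ : ∀ v ∈ clarkeSubdiff g x' + clarkeNormalCone X x', φ v < c) :
    Tendsto (fun j => max (φ (proxDisplacement T ζ (a j) (x j) w - ζ (x j) w) - c) 0) atTop
      (𝓝 0) := by
  have := FiniteDimensional.proper_real E
  have hbd : ∀ j, ‖proxDisplacement T ζ (a j) (x j) w - ζ (x j) w‖ ≤ 2 * (B + M) + M := fun j => by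
    have h1 := hT.norm_displacement_le hL hB (hx j) (hLB j) (ha j) ζ w
    have h2 := _root_.norm_sub_le (proxDisplacement T ζ (a j) (x j) w) (ζ (x j) w)
    linarith [hM j]
  have hstep : Tendsto (fun j => T (a j) (x j - a j • ζ (x j) w)) atTop (𝓝 x') := by
    refine (tendsto_iff_of_dist (f₁ := x) ?_).1 hx'
    have h0 : Tendsto (fun j => a j * (2 * (B + M))) atTop (𝓝 0) := by
      simpa using ha0.mul_const (2 * (B + M))
    refine squeeze_zero (fun _ => dist_nonneg) (fun j => ?_) h0
    rw [dist_eq_norm]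
    refine (hT.norm_sub_le hL hB (hx j) (hLB j) (ha j) _).trans ?_
    have := (ha j).le
    have := hM j
    gcongr
  -- The displacements are bounded for this sample, so every subsequence has a further one
  -- converging to some `v` in the limiting set. There `φ v < c`, so the positive part is eventually
  -- zero.
  refine tendsto_of_subseq_tendsto fun ns hns => ?_
  obtain ⟨v, -, m, hm, hv⟩ := (isCompact_closedBall (0 : E) (2 * (B + M) + M)).tendsto_subseq
    (x := fun j => proxDisplacement T ζ (a (ns j)) (x (ns j)) w - ζ (x (ns j)) w)
    fun j => by simpa using hbd (ns j)
  have hk : Tendsto (fun j => ns (m j)) atTop atTop := hns.comp hm.tendsto_atTop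
  have hmem : v ∈ clarkeSubdiff g x' + clarkeNormalCone X x' := by
    refine mem_of_tendsto_proximal_displacement hg hX (α := fun j => a (ns (m j)))
      (x := fun j => T (a (ns (m j))) (x (ns (m j)) - a (ns (m j)) • ζ (x (ns (m j))) w))
      (z := fun j => x (ns (m j)) - a (ns (m j)) • ζ (x (ns (m j))) w)
      (fun j => ha _) (fun j => hT.mem _ (ha _) _) (fun j => hT.isMin _ (ha _) _)
      (hstep.comp hk) (hv.congr fun j => ?_)
    simp only [Function.comp_apply, proxDisplacement]
    rw [sub_right_comm, smul_sub (a (ns (m j)))⁻¹ _ (a (ns (m j)) • _),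
      inv_smul_smul₀ (ha _).ne']
  refine ⟨m, ?_⟩
  have h1 : Tendsto (fun j => φ (proxDisplacement T ζ (a (ns (m j))) (x (ns (m j))) w -
      ζ (x (ns (m j))) w)) atTop (𝓝 (φ v)) := (φ.continuous.tendsto v).comp hv
  refine (tendsto_congr' ?_).2 tendsto_const_nhds
  filter_upwards [h1.eventually (gt_mem_nhds (hφ v hmem))] with j hj
  exact max_eq_right (by linarith)

/-- A Fatou lemma for sets. Were `v` outside, some `φ` and `c` would separate it; but `∫ (φ (D - ζ)
- c)` is at most the integral of the positive part, which tends to zero by dominated convergence,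
the dominating function coming from the integrability of `sup_k ‖ζ (x k) ω‖`. Hence `φ v ≤ c`, a
contradiction. -/
theorem IsProxSelection.mem_of_tendsto_integral (hT : IsProxSelection g X T)
    (hg : LocallyLipschitz g) (hX : IsClosed X) (hgrowth : GrowthCondition g)
    (hζ : IsSubgradientOracle P f X ζ)
    {x : ℕ → E} {a : ℕ → ℝ} (hx : ∀ j, x j ∈ X) (ha : ∀ j, 0 < a j)
    (ha0 : Tendsto a atTop (𝓝 0)) {x' v : E} (hx' : Tendsto x atTop (𝓝 x'))
    (hv : Tendsto (fun j => ∫ w, (proxDisplacement T ζ (a j) (x j) w - ζ (x j) w) ∂P) atTop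
      (𝓝 v)) : v ∈ clarkeSubdiff g x' + clarkeNormalCone X x' := by
  have := FiniteDimensional.proper_real E
  by_contra hcon
  obtain ⟨φ, c, hφ, hc⟩ := geometric_hahn_banach_closed_point
    (convex_clarkeSubdiff_add_clarkeNormalCone g X x')
    (isClosed_clarkeSubdiff_add_clarkeNormalCone hg X x') hcon
  have hgrowth' := hgrowth
  obtain ⟨L, hLb, hL⟩ := hgrowth'
  obtain ⟨B, hB, hLB⟩ := hLb.exists_bound (Metric.isBounded_range_of_tendsto x hx')
  have hLB' : ∀ j, L (x j) ≤ B := fun j => hLB _ (mem_range_self j)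
  set s : Ω → ℝ≥0∞ := fun w => ⨆ k, ‖ζ (x k) w‖ₑ with hs
  have hsm : Measurable s := .iSup fun k => (hζ.measurable_apply (x k)).enorm
  have hsfin : ∫⁻ w, s w ∂P < ∞ := hζ.locallyIntegrable x x' hx'
  have hsae : ∀ᵐ w ∂P, s w < ∞ := ae_lt_top hsm hsfin.ne
  have hle : ∀ w, s w < ∞ → ∀ j, ‖ζ (x j) w‖ ≤ (s w).toReal := fun w hw j => by
    rw [← toReal_enorm]
    exact ENNReal.toReal_mono hw.ne (le_iSup (fun k => ‖ζ (x k) w‖ₑ) j)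
  have hint : ∀ j, Integrable (fun w => proxDisplacement T ζ (a j) (x j) w - ζ (x j) w) P :=
    fun j => (hT.integrable_displacement hgrowth hζ (hx j) (ha j)).sub (hζ.integrable (hx j))
  have hint' : ∀ j, Integrable
      (fun w => φ (proxDisplacement T ζ (a j) (x j) w - ζ (x j) w) - c) P :=
    fun j => (φ.integrable_comp (hint j)).sub (integrable_const c)
  have hlim : Tendsto (fun j => ∫ w,
      max (φ (proxDisplacement T ζ (a j) (x j) w - ζ (x j) w) - c) 0 ∂P) atTop (𝓝 0) := by
    have hsint : Integrable (fun w => (s w).toReal) P :=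
      integrable_toReal_of_lintegral_ne_top hsm.aemeasurable hsfin.ne
    have := tendsto_integral_of_dominated_convergence (μ := P) (f := fun _ => (0 : ℝ))
      (F := fun j w => max (φ (proxDisplacement T ζ (a j) (x j) w - ζ (x j) w) - c) 0)
      (fun w => ‖φ‖ * (2 * (B + (s w).toReal) + (s w).toReal) + |c|)
      (fun j => (hint' j).pos_part.aestronglyMeasurable) ?_ (fun j => ?_) ?_
    · simpa using this
    · exact (((((integrable_const B).add hsint).const_mul 2).add hsint).const_mul ‖φ‖).add
        (integrable_const _)
    · filter_upwards [hsae] with w hw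
      have h1 := hT.norm_displacement_le hL hB (hx j) (hLB' j) (ha j) ζ w
      have h2 := _root_.norm_sub_le (proxDisplacement T ζ (a j) (x j) w) (ζ (x j) w)
      have h3 := hle w hw j
      have h4 := φ.le_opNorm (proxDisplacement T ζ (a j) (x j) w - ζ (x j) w)
      have h5 : ‖φ‖ * ‖proxDisplacement T ζ (a j) (x j) w - ζ (x j) w‖ ≤
          ‖φ‖ * (2 * (B + (s w).toReal) + (s w).toReal) := by
        gcongr
        linarith
      rw [Real.norm_of_nonneg (le_max_right _ _)]
      refine max_le ?_ (by positivity)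
      have h6 := le_abs_self (φ (proxDisplacement T ζ (a j) (x j) w - ζ (x j) w))
      rw [Real.norm_eq_abs] at h4
      linarith [neg_abs_le c]
    · filter_upwards [hsae] with w hw
      exact hT.tendsto_posPart_of_separation hg hX hL hB hx hLB' ha ha0 hx' (hle w hw) hφ
  have hφlim := (φ.continuous.tendsto v).comp hv
  have hle0 : φ v ≤ 0 + c := by
    refine le_of_tendsto_of_tendsto' hφlim (hlim.add_const c) fun j => ?_
    have h1 : φ (∫ w, (proxDisplacement T ζ (a j) (x j) w - ζ (x j) w) ∂P) - c =
        ∫ w, (φ (proxDisplacement T ζ (a j) (x j) w - ζ (x j) w) - c) ∂P := by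
      rw [integral_sub (φ.integrable_comp (hint j)) (integrable_const c),
        φ.integral_comp_comm (hint j)]
      simp
    have h2 := integral_mono (hint' j) (hint' j).pos_part fun w => le_max_left _ 0
    rw [← h1] at h2
    simp only [Function.comp_apply]
    linarith
  linarith

/-- Limits of mean displacements at vanishing step sizes belong to the composite field. -/
theorem IsProxSelection.neg_mem_compositeField_of_tendsto (hT : IsProxSelection g X T)
    (hf : LocallyLipschitz f) (hg : LocallyLipschitz g) (hX : IsClosed X)
    (hgrowth : GrowthCondition g) (hζ : IsSubgradientOracle P f X ζ)
    {x : ℕ → E} {a : ℕ → ℝ} (hx : ∀ j, x j ∈ X) (ha : ∀ j, 0 < a j)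
    (ha0 : Tendsto a atTop (𝓝 0)) {x' y : E} (hx' : Tendsto x atTop (𝓝 x'))
    (hy : Tendsto (fun j => meanDisplacement P T ζ (a j) (x j)) atTop (𝓝 y)) :
    -y ∈ compositeField f g X x' := by
  have := FiniteDimensional.proper_real E
  obtain ⟨K, s, hs, hK⟩ := hf x'
  have hbd : ∀ᶠ j in atTop, ∫ w, ζ (x j) w ∂P ∈ Metric.closedBall (0 : E) K := by
    filter_upwards [hx'.eventually (eventually_mem_nhds_iff.2 hs)] with j hj
    simpa using norm_le_of_mem_clarkeSubdiff hK hj (hζ.mean_mem _ (hx j))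
  -- Along a subsequence the mean of `ζ` settles at some `F ∈ ∂f`; the rest of the mean displacement
  -- then tends to `y - F`.
  obtain ⟨F, -, m, hm, hF⟩ := (isCompact_closedBall (0 : E) K).tendsto_subseq' hbd.frequently
  have hFmem : F ∈ clarkeSubdiff f x' :=
    hf.mem_clarkeSubdiff_of_tendsto (hx'.comp hm.tendsto_atTop) hF fun j => hζ.mean_mem _ (hx _)
  have hrest : y - F ∈ clarkeSubdiff g x' + clarkeNormalCone X x' := by
    refine hT.mem_of_tendsto_integral hg hX hgrowth hζ (fun j => hx (m j)) (fun j => ha (m j))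
      (ha0.comp hm.tendsto_atTop) (hx'.comp hm.tendsto_atTop)
      (((hy.comp hm.tendsto_atTop).sub hF).congr fun j => ?_)
    simp only [Function.comp_apply, meanDisplacement]
    exact (integral_sub (hT.integrable_displacement hgrowth hζ (hx _) (ha _))
      (hζ.integrable (hx _))).symm
  rw [compositeField, Set.neg_mem_neg, add_assoc]
  exact ⟨F, hFmem, y - F, hrest, by simp⟩

/-- Local uniformity follows from the sequential statement by contradiction, as mean displacements
are bounded along convergent sequences. A thickening of a convex set is convex, so averages of
drifts will stay in it. -/
theorem IsProxSelection.exists_neg_meanDisplacement_mem_cthickening (hT : IsProxSelection g X T)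
    (hf : LocallyLipschitz f) (hg : LocallyLipschitz g) (hX : IsClosed X)
    (hgrowth : GrowthCondition g) (hζ : IsSubgradientOracle P f X ζ)
    {α : ℕ → ℝ} (hα : ∀ k, 0 < α k) (hα0 : Tendsto α atTop (𝓝 0)) (x' : E)
    {ε : ℝ} (hε : 0 < ε) :
    ∃ δ > 0, ∃ K : ℕ, ∀ k ≥ K, ∀ x ∈ X, dist x x' < δ →
      -meanDisplacement P T ζ (α k) x ∈ Metric.cthickening ε (compositeField f g X x') := by
  have := FiniteDimensional.proper_real E
  by_contra! hcon
  choose k hk x hx hxx' hnot using fun n : ℕ =>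
    hcon (1 / (n + 1 : ℝ)) Nat.one_div_pos_of_nat n
  have hk' : Tendsto k atTop atTop := tendsto_atTop_mono hk tendsto_id
  have hlim : Tendsto x atTop (𝓝 x') := by
    rw [tendsto_iff_dist_tendsto_zero]
    exact squeeze_zero (fun _ => dist_nonneg) (fun n => (hxx' n).le)
      tendsto_one_div_add_atTop_nhds_zero_nat
  obtain ⟨C, -, hC⟩ := hT.exists_meanDisplacement_bound hgrowth hζ
    (Metric.isBounded_range_of_tendsto x hlim)
  obtain ⟨y, -, m, hm, hy⟩ := (isCompact_closedBall (0 : E) C).tendsto_subseq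
    (x := fun n => meanDisplacement P T ζ (α (k n)) (x n)) fun n => by
      simpa using hC (x n) (mem_range_self n) (hx n) _ (hα _)
  have hmem := hT.neg_mem_compositeField_of_tendsto hf hg hX hgrowth hζ (fun j => hx (m j))
    (fun j => hα (k (m j))) (hα0.comp (hk'.comp hm.tendsto_atTop)) (hlim.comp hm.tendsto_atTop) hy
  have hnhds : Metric.thickening ε (compositeField f g X x') ∈ 𝓝 (-y) :=
    Metric.isOpen_thickening.mem_nhds (Metric.self_subset_thickening hε _ hmem)
  obtain ⟨j, hj⟩ := (hy.neg.eventually hnhds).exists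
  exact hnot (m j) (Metric.thickening_subset_cthickening _ _ hj)

end Displacement

/-! ### Convergence of square-summable orthogonal noise. -/

section Martingale

variable {S : Type*} {mS : MeasurableSpace S} {μ : Measure S} [IsProbabilityMeasure μ]

/-- A series of increments with summable variances, each orthogonal to every function of the past,
converges almost surely. -/
theorem ae_exists_tendsto_sum_of_orthogonal {F : Filtration ℕ mS} {D : ℕ → S → ℝ}
    (hD : ∀ n, Measurable[F (n + 1)] (D n)) (hL2 : ∀ n, MemLp (D n) 2 μ)
    (horth : ∀ n (Z : S → ℝ), Measurable[F n] Z → ∫ s, Z s * D n s ∂μ = 0)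
    (hsum : Summable fun n => ∫ s, D n s ^ 2 ∂μ) :
    ∀ᵐ s ∂μ, ∃ c, Tendsto (fun n => ∑ k ∈ Finset.range n, D k s) atTop (𝓝 c) := by
  set M : ℕ → S → ℝ := fun n s => ∑ k ∈ Finset.range n, D k s with hM
  have hMF : ∀ n, Measurable[F n] (M n) := fun n =>
    Finset.measurable_fun_sum _ fun k hk =>
      (hD k).mono (F.mono (Finset.mem_range.1 hk)) le_rfl
  have hML2 : ∀ n, MemLp (M n) 2 μ := fun n => memLp_finsetSum _ fun k _ => hL2 k
  have hMint : ∀ n, Integrable (M n) μ := fun n => (hML2 n).integrable (by norm_num)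
  have hDint : ∀ n, Integrable (D n) μ := fun n => (hL2 n).integrable (by norm_num)
  have hsucc : ∀ n, M (n + 1) = fun s => M n s + D n s := fun n => by
    ext s
    simp [hM, Finset.sum_range_succ]
  have hmart : Martingale M F μ := by
    refine martingale_nat (fun n => (hMF n).stronglyMeasurable) hMint fun n => ?_
    refine ae_eq_condExp_of_forall_setIntegral_eq (F.le n) (hMint _)
      (fun A _ _ => (hMint n).integrableOn) (fun A hA _ => ?_)
      (hMF n).stronglyMeasurable.aestronglyMeasurable
    -- Orthogonality tested on indicators of past events is the martingale property; tested on `M n`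
    -- below, it gives Pythagoras for the variances.
    have h0 : ∫ s in A, D n s ∂μ = 0 := by
      rw [← integral_indicator (F.le n _ hA), ← horth n (A.indicator 1)
        ((measurable_const (a := (1 : ℝ))).indicator hA)]
      refine integral_congr_ae (Eventually.of_forall fun s => ?_)
      by_cases hs : s ∈ A <;> simp [hs]
    rw [hsucc n, integral_add (hMint n).integrableOn (hDint n).integrableOn, h0, add_zero]
  have hsq : ∀ n, ∫ s, M n s ^ 2 ∂μ = ∑ k ∈ Finset.range n, ∫ s, D k s ^ 2 ∂μ := by
    intro n
    induction n with
    | zero => simp [hM]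
    | succ n ih =>
      have h1 : ∀ s, M (n + 1) s ^ 2 = M n s ^ 2 + 2 * (M n s * D n s) + D n s ^ 2 := fun s => by
        rw [hsucc n]
        ring
      have hMD : Integrable (fun s => M n s * D n s) μ := (hML2 n).integrable_mul (hL2 n)
      simp_rw [h1]
      have h2 : ∫ s, (M n s ^ 2 + 2 * (M n s * D n s) + D n s ^ 2) ∂μ =
          ∫ s, (M n s ^ 2 + 2 * (M n s * D n s)) ∂μ + ∫ s, D n s ^ 2 ∂μ :=
        integral_add ((hML2 n).integrable_sq.add (hMD.const_mul 2)) (hL2 n).integrable_sq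
      rw [h2, integral_add (hML2 n).integrable_sq (hMD.const_mul 2), integral_const_mul,
        horth n _ (hMF n), ih, Finset.sum_range_succ]
      ring
  -- The `1` comes from `|t| ≤ 1 + t²`, which turns the L² bound into the L¹ bound that martingale
  -- convergence requires.
  set B : ℝ := 1 + ∑' k, ∫ s, D k s ^ 2 ∂μ with hB
  have hbound : ∀ n, eLpNorm (M n) 1 μ ≤ (B.toNNReal : ℝ≥0∞) := fun n => by
    rw [eLpNorm_one_eq_lintegral_enorm, ← ofReal_integral_norm_eq_lintegral_enorm (hMint n)]
    refine ENNReal.ofReal_le_ofReal ?_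
    calc ∫ s, ‖M n s‖ ∂μ ≤ ∫ s, (1 + M n s ^ 2) ∂μ := by
          refine integral_mono (hMint n).norm
            ((integrable_const _).add (hML2 n).integrable_sq) fun s => ?_
          simp only [Real.norm_eq_abs]
          nlinarith [sq_nonneg (|M n s| - 1), sq_abs (M n s)]
      _ = 1 + ∑ k ∈ Finset.range n, ∫ s, D k s ^ 2 ∂μ := by
          rw [integral_add (integrable_const _) (hML2 n).integrable_sq, hsq]
          simp
      _ ≤ B := by
          rw [hB]
          gcongr
          exact hsum.sum_le_tsum _ fun k _ => integral_nonneg fun s => sq_nonneg _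
  filter_upwards [hmart.submartingale.ae_tendsto_limitProcess hbound] with s hs
  exact ⟨_, hs⟩

variable {E Ω : Type*} [MeasurableSpace E] [MeasurableSpace Ω] {P : Measure Ω}
  [IsProbabilityMeasure P]

/-- The product form of the joint law lets Fubini replace conditional expectations: the past is
frozen while the fresh sample is integrated. -/
theorem map_prod_eq_of_indep (F : Filtration ℕ mS) (n : ℕ) {β : Type*} [MeasurableSpace β]
    {Y : S → β} (hY : Measurable[F n] Y) {ω : S → Ω} (hω : Measurable ω) (hlaw : μ.map ω = P)
    (hind : Indep (F n) (MeasurableSpace.comap ω inferInstance) μ) :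
    μ.map (fun s => (Y s, ω s)) = (μ.map Y).prod P := by
  have h : IndepFun Y ω μ := by
    rw [IndepFun_iff_Indep]
    exact indep_of_indep_of_le_left hind hY.comap_le
  rw [(indepFun_iff_map_prod_eq_prod_map_map (hY.mono (F.le n) le_rfl).aemeasurable
    hω.aemeasurable).1 h, hlaw]

/-- A centred function of the past and of an independent sample is orthogonal to the past. -/
theorem integral_mul_eq_zero_of_indep (F : Filtration ℕ mS) (n : ℕ)
    {Z : S → ℝ} (hZ : Measurable[F n] Z) {Y : S → E} (hY : Measurable[F n] Y)
    {ω : S → Ω} (hω : Measurable ω) (hlaw : μ.map ω = P)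
    (hind : Indep (F n) (MeasurableSpace.comap ω inferInstance) μ)
    {h : E → Ω → ℝ} (hh : Measurable fun q : E × Ω => h q.1 q.2) (h0 : ∀ x, ∫ w, h x w ∂P = 0) :
    ∫ s, Z s * h (Y s) (ω s) ∂μ = 0 := by
  have hZY : Measurable[F n] fun s => (Z s, Y s) := hZ.prodMk hY
  have hmap := map_prod_eq_of_indep F n hZY hω hlaw hind
  have hprob : IsProbabilityMeasure (μ.map fun s => (Z s, Y s)) :=
    Measure.isProbabilityMeasure_map (hZY.mono (F.le n) le_rfl).aemeasurable
  have hmeas : Measurable fun q : (ℝ × E) × Ω => q.1.1 * h q.1.2 q.2 :=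
    (measurable_fst.comp measurable_fst).mul
      (hh.comp ((measurable_snd.comp measurable_fst).prodMk measurable_snd))
  have h1 : ∫ s, Z s * h (Y s) (ω s) ∂μ =
      ∫ q, q.1.1 * h q.1.2 q.2 ∂((μ.map fun s => (Z s, Y s)).prod P) := by
    rw [← hmap, integral_map ((hZY.mono (F.le n) le_rfl).prodMk hω).aemeasurable
      hmeas.aestronglyMeasurable]
  rw [h1]
  -- No integrability is asked of `Z`: when the product is not integrable, its Bochner integral is
  -- `0` by convention.
  by_cases hint : Integrable (fun q : (ℝ × E) × Ω => q.1.1 * h q.1.2 q.2)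
      ((μ.map fun s => (Z s, Y s)).prod P)
  · rw [integral_prod _ hint]
    simp [integral_const_mul, h0]
  · exact integral_undef hint

theorem integrable_sq_of_indep (F : Filtration ℕ mS) (n : ℕ)
    {Y : S → E} (hY : Measurable[F n] Y)
    {ω : S → Ω} (hω : Measurable ω) (hlaw : μ.map ω = P)
    (hind : Indep (F n) (MeasurableSpace.comap ω inferInstance) μ)
    {h : E → Ω → ℝ} (hh : Measurable fun q : E × Ω => h q.1 q.2) {C : ℝ} (hC : 0 ≤ C)
    (hhC : ∀ x, Integrable (fun w => h x w ^ 2) P ∧ ∫ w, h x w ^ 2 ∂P ≤ C) :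
    Integrable (fun s => h (Y s) (ω s) ^ 2) μ ∧ ∫ s, h (Y s) (ω s) ^ 2 ∂μ ≤ C := by
  have hmap := map_prod_eq_of_indep F n hY hω hlaw hind
  have hprob : IsProbabilityMeasure (μ.map Y) :=
    Measure.isProbabilityMeasure_map (hY.mono (F.le n) le_rfl).aemeasurable
  have hYω : Measurable fun s => (Y s, ω s) := (hY.mono (F.le n) le_rfl).prodMk hω
  have hm2 : Measurable fun q : E × Ω => ENNReal.ofReal (h q.1 q.2 ^ 2) :=
    (hh.pow_const 2).ennreal_ofReal
  have hms : Measurable fun s => h (Y s) (ω s) := hh.comp hYω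
  have hle : ∫⁻ s, ENNReal.ofReal (h (Y s) (ω s) ^ 2) ∂μ ≤ ENNReal.ofReal C := by
    calc ∫⁻ s, ENNReal.ofReal (h (Y s) (ω s) ^ 2) ∂μ
        = ∫⁻ q, ENNReal.ofReal (h q.1 q.2 ^ 2) ∂(μ.map fun s => (Y s, ω s)) :=
          (lintegral_map hm2 hYω).symm
      _ = ∫⁻ x, ∫⁻ w, ENNReal.ofReal (h x w ^ 2) ∂P ∂(μ.map Y) := by
          rw [hmap, lintegral_prod _ hm2.aemeasurable]
      _ ≤ ∫⁻ _, ENNReal.ofReal C ∂(μ.map Y) := by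
          refine lintegral_mono fun x => ?_
          rw [← ofReal_integral_eq_lintegral_ofReal (hhC x).1
            (Eventually.of_forall fun w => sq_nonneg _)]
          exact ENNReal.ofReal_le_ofReal (hhC x).2
      _ = ENNReal.ofReal C := by simp
  constructor
  · refine ⟨(hms.pow_const 2).aestronglyMeasurable, ?_⟩
    rw [hasFiniteIntegral_iff_ofReal (Eventually.of_forall fun s => sq_nonneg _)]
    exact hle.trans_lt ENNReal.ofReal_lt_top
  · rw [integral_eq_lintegral_of_nonneg_ae (Eventually.of_forall fun s => sq_nonneg _)
      (hms.pow_const 2).aestronglyMeasurable]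
    exact ENNReal.toReal_le_of_le_ofReal hC hle

/-- Almost sure convergence of a weighted series of centred functions of a predictable process and
of independent samples. -/
theorem ae_exists_tendsto_sum_of_indep {F : Filtration ℕ mS} {ω : ℕ → S → Ω}
    (hω : ∀ n, Measurable[F (n + 1)] (ω n)) (hlaw : ∀ n, μ.map (ω n) = P)
    (hind : ∀ n, Indep (F n) (MeasurableSpace.comap (ω n) inferInstance) μ)
    {Y : ℕ → S → E} (hY : ∀ n, Measurable[F n] (Y n)) {h : ℕ → E → Ω → ℝ}
    (hh : ∀ n, Measurable fun q : E × Ω => h n q.1 q.2) {C : ℝ} (hC : 0 ≤ C)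
    (hhC : ∀ n x, Integrable (fun w => h n x w ^ 2) P ∧ ∫ w, h n x w ^ 2 ∂P ≤ C)
    (h0 : ∀ n x, ∫ w, h n x w ∂P = 0) {α : ℕ → ℝ} (hα : Summable fun n => α n ^ 2) :
    ∀ᵐ s ∂μ, ∃ c, Tendsto (fun n => ∑ k ∈ Finset.range n, α k * h k (Y k s) (ω k s)) atTop
      (𝓝 c) := by
  have hω' : ∀ n, Measurable (ω n) := fun n => (hω n).mono (F.le _) le_rfl
  have hm : ∀ n, Measurable[F (n + 1)] fun s => h n (Y n s) (ω n s) := fun n =>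
    (hh n).comp (((hY n).mono (F.mono n.le_succ) le_rfl).prodMk (hω n))
  have hsq := fun n => integrable_sq_of_indep F n (hY n) (hω' n) (hlaw n) (hind n) (hh n) hC
    (hhC n)
  have hm' : ∀ n, Measurable[F (n + 1)] fun s => α n * h n (Y n s) (ω n s) := fun n =>
    (hm n).const_mul (α n)
  refine ae_exists_tendsto_sum_of_orthogonal hm' (fun n => ?_) (fun n Z hZ => ?_) ?_
  · rw [memLp_two_iff_integrable_sq ((hm' n).mono (F.le _) le_rfl).aestronglyMeasurable]
    simp_rw [mul_pow]
    exact (hsq n).1.const_mul _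
  · have := integral_mul_eq_zero_of_indep F n (hZ.mul_const (α n)) (hY n) (hω' n) (hlaw n)
      (hind n) (hh n) (h0 n)
    simpa only [mul_assoc] using this
  · refine Summable.of_nonneg_of_le (fun n => integral_nonneg fun s => sq_nonneg _) (fun n => ?_)
      (hα.mul_right C)
    simp_rw [mul_pow]
    rw [integral_const_mul]
    exact mul_le_mul_of_nonneg_left (hsq n).2 (sq_nonneg _)

end Martingale

/-! ### The filtration of the samples and its independence of the next one. -/

section History

variable {S E Ω : Type*} [mS : MeasurableSpace S] [MeasurableSpace E] [MeasurableSpace Ω]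
  {μ : Measure S} [IsProbabilityMeasure μ]

/-- The initial point together with the first `n` samples. -/
def sampleHistory (x₀ : S → E) (ω : ℕ → S → Ω) (n : ℕ) (s : S) : E × (Finset.range n → Ω) :=
  (x₀ s, fun i => ω i s)

theorem measurable_sampleHistory {x₀ : S → E} (hx₀ : Measurable x₀) {ω : ℕ → S → Ω}
    (hω : ∀ k, Measurable (ω k)) (n : ℕ) : Measurable (sampleHistory x₀ ω n) :=
  hx₀.prodMk (measurable_pi_lambda _ fun i => hω i)

/-- The filtration generated by the initial point and the samples. -/
def sampleFiltration {x₀ : S → E} (hx₀ : Measurable x₀) {ω : ℕ → S → Ω}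
    (hω : ∀ k, Measurable (ω k)) : Filtration ℕ mS where
  seq n := MeasurableSpace.comap (sampleHistory x₀ ω n) inferInstance
  mono' n m hnm := by
    have h : Measurable fun q : E × (Finset.range m → Ω) =>
        (q.1, fun i : Finset.range n => q.2 ⟨i, Finset.range_mono hnm i.2⟩) :=
      measurable_fst.prodMk (measurable_pi_lambda _ fun i =>
        (measurable_pi_apply _).comp measurable_snd)
    exact (h.comp (comap_measurable (sampleHistory x₀ ω m))).comap_le
  le' n := (measurable_sampleHistory hx₀ hω n).comap_le

theorem measurable_initial_sampleFiltration {x₀ : S → E} (hx₀ : Measurable x₀) {ω : ℕ → S → Ω}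
    (hω : ∀ k, Measurable (ω k)) (n : ℕ) : Measurable[sampleFiltration hx₀ hω n] x₀ :=
  measurable_fst.comp (comap_measurable (sampleHistory x₀ ω n))

theorem measurable_sample_sampleFiltration {x₀ : S → E} (hx₀ : Measurable x₀) {ω : ℕ → S → Ω}
    (hω : ∀ k, Measurable (ω k)) (n : ℕ) : Measurable[sampleFiltration hx₀ hω (n + 1)] (ω n) :=
  ((measurable_pi_apply (⟨n, Finset.self_mem_range_succ n⟩ : Finset.range (n + 1))).comp
    measurable_snd).comp (comap_measurable (sampleHistory x₀ ω (n + 1)))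

/-- The joint law is `A ⊗ (U ⊗ V)`; reassociating gives `(A ⊗ U) ⊗ V`. It serves for the initial
point, the first `n` samples and the next sample. -/
theorem indepFun_prodMk_left_of_indepFun {β γ δ : Type*} [MeasurableSpace β] [MeasurableSpace γ]
    [MeasurableSpace δ] {A : S → β} {U : S → γ} {V : S → δ} (hA : Measurable A)
    (hU : Measurable U) (hV : Measurable V) (h : IndepFun A (fun s => (U s, V s)) μ)
    (hUV : IndepFun U V μ) : IndepFun (fun s => (A s, U s)) V μ := by
  have hAU : IndepFun A U μ := h.comp measurable_id measurable_fst
  have h1 := (indepFun_iff_map_prod_eq_prod_map_map hA.aemeasurable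
    (hU.prodMk hV).aemeasurable).1 h
  rw [(indepFun_iff_map_prod_eq_prod_map_map hU.aemeasurable hV.aemeasurable).1 hUV] at h1
  have := Measure.isProbabilityMeasure_map (μ := μ) hA.aemeasurable
  have := Measure.isProbabilityMeasure_map (μ := μ) hU.aemeasurable
  have := Measure.isProbabilityMeasure_map (μ := μ) hV.aemeasurable
  rw [indepFun_iff_map_prod_eq_prod_map_map (hA.prodMk hU).aemeasurable hV.aemeasurable,
    (indepFun_iff_map_prod_eq_prod_map_map hA.aemeasurable hU.aemeasurable).1 hAU]
  rw [← Measure.prodAssoc_prod] at h1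
  have h2 := congrArg (Measure.map (MeasurableEquiv.prodAssoc (α := β) (β := γ) (γ := δ)).symm) h1
  rw [Measure.map_map (MeasurableEquiv.measurable _) (hA.prodMk (hU.prodMk hV)),
    Measure.map_map (MeasurableEquiv.measurable _) (MeasurableEquiv.measurable _)] at h2
  simpa [Function.comp_def, MeasurableEquiv.prodAssoc] using h2

theorem indep_sampleFiltration {x₀ : S → E} (hx₀ : Measurable x₀) {ω : ℕ → S → Ω}
    (hω : ∀ k, Measurable (ω k)) (hind : iIndepFun ω μ)
    (hx₀ind : IndepFun x₀ (fun s k => ω k s) μ) (n : ℕ) :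
    Indep (sampleFiltration hx₀ hω n) (MeasurableSpace.comap (ω n) inferInstance) μ := by
  have hU : Measurable fun s (i : Finset.range n) => ω i s := measurable_pi_lambda _ fun i => hω i
  have hUV : IndepFun (fun s (i : Finset.range n) => ω i s) (ω n) μ := by
    have := hind.indepFun_finset (Finset.range n) {n} (by simp) hω
    exact this.comp measurable_id
      (measurable_pi_apply (⟨n, Finset.mem_singleton_self n⟩ : ({n} : Finset ℕ)))
  have hA : IndepFun x₀ (fun s => (fun i : Finset.range n => ω i s, ω n s)) μ :=
    hx₀ind.comp measurable_id (ψ := fun q : ℕ → Ω => (fun i : Finset.range n => q i, q n))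
      ((measurable_pi_lambda _ fun i => measurable_pi_apply _).prodMk (measurable_pi_apply n))
  exact (IndepFun_iff_Indep _ _ _).1 (indepFun_prodMk_left_of_indepFun hx₀ hU (hω n) hA hUV)

end History

/-! ### Almost sure summability of the weighted noise. -/

section Noise

variable {E : Type*} [NormedAddCommGroup E] [InnerProductSpace ℝ E] [FiniteDimensional ℝ E]
  [CompleteSpace E] [MeasurableSpace E] [BorelSpace E]
  {Ω : Type*} [MeasurableSpace Ω] {P : Measure Ω} [IsProbabilityMeasure P]
  {f g : E → ℝ} {X : Set E} {ζ : E → Ω → E} {T : ℝ → E → E}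
  {S : Type*} [mS : MeasurableSpace S] {μ : Measure S} [IsProbabilityMeasure μ]

theorem measurable_proxSubgradIter (hζ : IsSubgradientOracle P f X ζ) (hT : IsProxSelection g X T)
    {α : ℕ → ℝ} (hα : ∀ k, 0 < α k) {x₀ : S → E} (hx₀ : Measurable x₀) {ω : ℕ → S → Ω}
    (hω : ∀ k, Measurable (ω k)) (n : ℕ) :
    Measurable[sampleFiltration hx₀ hω n] (proxSubgradIter T ζ α x₀ ω n) := by
  have := FiniteDimensional.proper_real E
  induction n with
  | zero => exact measurable_initial_sampleFiltration hx₀ hω 0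
  | succ n ih =>
    have h1 := ih.mono ((sampleFiltration hx₀ hω).mono n.le_succ) le_rfl
    have h2 := measurable_sample_sampleFiltration hx₀ hω n
    have h3 := hζ.measurable.comp (h1.prodMk h2)
    exact (hT.measurable_apply (hα n)).comp (h1.sub (h3.const_smul (α n)))

theorem IsProxSelection.measurable_meanDisplacement (hT : IsProxSelection g X T)
    (hζ : IsSubgradientOracle P f X ζ) {a : ℝ} (ha : 0 < a) :
    Measurable (meanDisplacement P T ζ a) := by
  have := FiniteDimensional.proper_real E
  have h := (hT.measurable_proxDisplacement hζ.measurable ha).stronglyMeasurable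
  exact (StronglyMeasurable.integral_prod_right (ν := P)
    (f := fun x w => proxDisplacement T ζ a x w) h).measurable

/-- The noise of the iteration, weighted by the step sizes, is almost surely summable along
bounded iterates. -/
theorem ae_exists_tendsto_noise (hζ : IsSubgradientOracle P f X ζ) (hT : IsProxSelection g X T)
    (hX : IsClosed X) (hgrowth : GrowthCondition g)
    {α : ℕ → ℝ} (hα : ∀ k, 0 < α k) (hα_sq : Summable fun k => α k ^ 2)
    {x₀ : S → E} (hx₀ : Measurable x₀) {ω : ℕ → S → Ω} (hω : ∀ k, Measurable (ω k))
    (hlaw : ∀ k, μ.map (ω k) = P) (hind : iIndepFun ω μ)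
    (hx₀ind : IndepFun x₀ (fun s k => ω k s) μ) :
    ∀ᵐ s ∂μ, (∀ k, proxSubgradIter T ζ α x₀ ω k s ∈ X) →
      (∃ C : ℝ, ∀ k, ‖proxSubgradIter T ζ α x₀ ω k s‖ ≤ C) →
      ∃ c, Tendsto (fun n => ∑ k ∈ Finset.range n,
        α k • (meanDisplacement P T ζ (α k) (proxSubgradIter T ζ α x₀ ω k s) -
          proxDisplacement T ζ (α k) (proxSubgradIter T ζ α x₀ ω k s) (ω k s))) atTop (𝓝 c) := by
  have := FiniteDimensional.proper_real E
  let b := stdOrthonormalBasis ℝ E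
  -- Moment bounds hold only on bounded parts of `X`, so the noise is cut off outside `X ∩
  -- closedBall 0 R` and treated coordinate by coordinate. The cutoff depends on `x` alone, so
  -- centring survives.
  let h : ℕ → Fin (Module.finrank ℝ E) → ℕ → E → Ω → ℝ := fun R i k x w =>
    (X ∩ Metric.closedBall 0 R).indicator (fun x => inner ℝ (b i)
      (meanDisplacement P T ζ (α k) x - proxDisplacement T ζ (α k) x w)) x
  have hXR : ∀ R : ℕ, MeasurableSet (X ∩ Metric.closedBall (0 : E) R) := fun R =>
    hX.measurableSet.inter measurableSet_closedBall
  have key : ∀ (R : ℕ) i, ∀ᵐ s ∂μ, ∃ c, Tendsto (fun n => ∑ k ∈ Finset.range n,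
      α k * h R i k (proxSubgradIter T ζ α x₀ ω k s) (ω k s)) atTop (𝓝 c) := by
    intro R i
    obtain ⟨C₁, hC₁, h1⟩ := hT.exists_meanDisplacement_bound hgrowth hζ
      (Metric.isBounded_closedBall (x := (0 : E)) (r := (R : ℝ)))
    obtain ⟨C₂, hC₂, h2⟩ := hT.exists_moment_bound hgrowth hζ
      (Metric.isBounded_closedBall (x := (0 : E)) (r := (R : ℝ)))
    have hmG : ∀ k, Measurable fun q : E × Ω =>
        inner ℝ (b i) (meanDisplacement P T ζ (α k) q.1 - proxDisplacement T ζ (α k) q.1 q.2) :=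
      fun k => measurable_const.inner (((hT.measurable_meanDisplacement hζ (hα k)).comp
        measurable_fst).sub (hT.measurable_proxDisplacement hζ.measurable (hα k)))
    refine ae_exists_tendsto_sum_of_indep (F := sampleFiltration hx₀ hω)
      (measurable_sample_sampleFiltration hx₀ hω) hlaw
      (indep_sampleFiltration hx₀ hω hind hx₀ind)
      (measurable_proxSubgradIter hζ hT hα hx₀ hω) (fun k => ?_)
      (C := 2 * (C₁ ^ 2 + C₂)) (by positivity) (fun k x => ?_) (fun k x => ?_) hα_sq
    · exact (hmG k).indicator (measurable_fst (hXR R))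
    · by_cases hx : x ∈ X ∩ Metric.closedBall 0 R
      · simp only [h, indicator_of_mem hx]
        have hx1 := h1 x hx.2 hx.1 _ (hα k)
        obtain ⟨hx2, hx3⟩ := h2 x hx.2 hx.1 _ (hα k)
        have hle : ∀ w, inner ℝ (b i)
            (meanDisplacement P T ζ (α k) x - proxDisplacement T ζ (α k) x w) ^ 2 ≤
              2 * (C₁ ^ 2 + ‖proxDisplacement T ζ (α k) x w‖ ^ 2) := fun w => by
          have h3 := abs_real_inner_le_norm (b i)
            (meanDisplacement P T ζ (α k) x - proxDisplacement T ζ (α k) x w)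
          rw [b.norm_eq_one, one_mul] at h3
          have h4 := h3.trans (_root_.norm_sub_le _ _)
          have h5 : |inner ℝ (b i) (meanDisplacement P T ζ (α k) x -
              proxDisplacement T ζ (α k) x w)| ≤ C₁ + ‖proxDisplacement T ζ (α k) x w‖ := by
            linarith
          rw [← sq_abs]
          have h6 := pow_le_pow_left₀ (abs_nonneg _) h5 2
          nlinarith [sq_nonneg (C₁ - ‖proxDisplacement T ζ (α k) x w‖)]
        have hint : Integrable (fun w => 2 * (C₁ ^ 2 + ‖proxDisplacement T ζ (α k) x w‖ ^ 2)) P :=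
          ((integrable_const _).add hx2).const_mul 2
        have hint' : Integrable (fun w => inner ℝ (b i)
            (meanDisplacement P T ζ (α k) x - proxDisplacement T ζ (α k) x w) ^ 2) P :=
          hint.mono' (((hmG k).comp measurable_prodMk_left).pow_const 2).aestronglyMeasurable
            (Eventually.of_forall fun w => by
              rw [Real.norm_of_nonneg (sq_nonneg _)]
              exact hle w)
        refine ⟨hint', (integral_mono hint' hint hle).trans ?_⟩
        rw [integral_const_mul, integral_add (integrable_const _) hx2]
        simp only [integral_const, probReal_univ, one_smul]
        linarith
      · simp only [h, indicator_of_notMem hx]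
        simp only [ne_eq, OfNat.ofNat_ne_zero, not_false_eq_true, zero_pow, integral_zero]
        exact ⟨integrable_zero _ _ _, by positivity⟩
    · by_cases hx : x ∈ X ∩ Metric.closedBall 0 R
      · simp only [h, indicator_of_mem hx]
        have hi := hT.integrable_displacement hgrowth hζ hx.1 (hα k)
        refine (integral_inner (f := fun w => meanDisplacement P T ζ (α k) x -
          proxDisplacement T ζ (α k) x w) ((integrable_const _).sub hi) (b i)).trans ?_
        rw [integral_sub (integrable_const _) hi]
        simp [meanDisplacement]
      · simp [h, indicator_of_notMem hx]
  -- The bound on the iterates depends on `s`. One null set serves all natural `R`, and for `R`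
  -- large enough the cutoff never acts on this path.
  filter_upwards [ae_all_iff.2 fun R => ae_all_iff.2 (key R)] with s hs hsX hsC
  obtain ⟨C, hC⟩ := hsC
  obtain ⟨R, hR⟩ := exists_nat_ge C
  choose c hc using hs R
  refine ⟨∑ i, c i • b i, ?_⟩
  refine (tendsto_finsetSum _ fun i _ => (hc i).smul_const (b i)).congr fun n => ?_
  have hmem : ∀ k, proxSubgradIter T ζ α x₀ ω k s ∈ X ∩ Metric.closedBall 0 (R : ℝ) := fun k =>
    ⟨hsX k, by simpa using (hC k).trans hR⟩
  simp only [h, indicator_of_mem (hmem _), Finset.sum_smul]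
  rw [Finset.sum_comm]
  refine Finset.sum_congr rfl fun k _ => ?_
  simp only [mul_smul]
  rw [← Finset.smul_sum]
  congr 1
  exact b.sum_repr' _

end Noise

/-! ### Lipschitz curves as arcs. -/

section Arc

variable {E : Type*} [NormedAddCommGroup E] [InnerProductSpace ℝ E] [CompleteSpace E]
  [FiniteDimensional ℝ E]

/-- Lipschitz curves are absolutely continuous. -/
theorem LipschitzWith.isArc {z : ℝ → E} {K : NNReal} (hz : LipschitzWith K z) : IsArc z := by
  have hint : ∀ a b, IntervalIntegrable (deriv z) volume a b := fun a b => by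
    refine (intervalIntegrable_const (c := (K : ℝ))).mono_fun
      (stronglyMeasurable_deriv z).aestronglyMeasurable (Eventually.of_forall fun t => ?_)
    simpa using norm_deriv_le_of_lipschitz hz
  refine ⟨deriv z, fun t _ => hint 0 t, fun t _ => ?_⟩
  rw [← sub_eq_iff_eq_add']
  -- Pairing with `e` reduces the claim to the scalar fundamental theorem of calculus.
  refine ext_inner_left ℝ fun e => ?_
  have h1 : LipschitzWith (‖innerSL ℝ e‖₊ * K) fun t => inner ℝ e (z t) :=
    (innerSL ℝ e).lipschitz.comp hz
  have h2 := (h1.lipschitzOnWith (s := uIcc 0 t)).absolutelyContinuousOnInterval.integral_deriv_eq_sub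
  have h3 : ∫ s in (0 : ℝ)..t, deriv (fun t => inner ℝ e (z t)) s =
      ∫ s in (0 : ℝ)..t, innerSL ℝ e (deriv z s) := by
    refine intervalIntegral.integral_congr_ae ?_
    filter_upwards [hz.ae_differentiableAt] with s hs _
    exact ((innerSL ℝ e).hasFDerivAt.comp_hasDerivAt s hs.hasDerivAt).deriv
  rw [h3, (innerSL ℝ e).intervalIntegral_comp_comm (hint 0 t)] at h2
  rw [inner_sub_right, ← h2]
  rfl

end Arc

/-! ### Limit trajectories of noisy iterations and the Lyapunov argument. -/

section Dynamics

variable {E : Type*} [NormedAddCommGroup E] [InnerProductSpace ℝ E]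

/-- A bounded iteration with vanishing, non-summable step sizes, bounded drift and summable
noise. -/
structure IsNoisyIteration (α : ℕ → ℝ) (x y ξ : ℕ → E) (C R : ℝ) : Prop where
  pos : ∀ n, 0 < α n
  tendsto_zero : Tendsto α atTop (𝓝 0)
  not_summable : ¬ Summable α
  step : ∀ n, x (n + 1) = x n + α n • (y n + ξ n)
  drift_le : ∀ n, ‖y n‖ ≤ C
  noise : ∃ c, Tendsto (fun n => ∑ k ∈ Finset.range n, α k • ξ k) atTop (𝓝 c)
  bounded : ∀ n, ‖x n‖ ≤ R

/-- The time elapsed before the `n`-th step. -/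
def elapsedTime (α : ℕ → ℝ) (n : ℕ) : ℝ := ∑ k ∈ Finset.range n, α k

/-- The first index at which at least time `t` has elapsed since step `n`. -/
noncomputable def indexAfter (α : ℕ → ℝ) (n : ℕ) (t : ℝ) : ℕ :=
  sInf {m | elapsedTime α n + t ≤ elapsedTime α m}

namespace IsNoisyIteration

variable {α : ℕ → ℝ} {x y ξ : ℕ → E} {C R : ℝ}

theorem elapsedTime_strictMono (h : IsNoisyIteration α x y ξ C R) :
    StrictMono (elapsedTime α) :=
  strictMono_nat_of_lt_succ fun n => by
    simp only [elapsedTime, Finset.sum_range_succ]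
    linarith [h.pos n]

theorem elapsedTime_tendsto (h : IsNoisyIteration α x y ξ C R) :
    Tendsto (elapsedTime α) atTop atTop :=
  (not_summable_iff_tendsto_nat_atTop_of_nonneg fun n => (h.pos n).le).1 h.not_summable

theorem le_elapsedTime_indexAfter (h : IsNoisyIteration α x y ξ C R) (n : ℕ) (t : ℝ) :
    elapsedTime α n + t ≤ elapsedTime α (indexAfter α n t) :=
  Nat.sInf_mem (s := {m | elapsedTime α n + t ≤ elapsedTime α m})
    (h.elapsedTime_tendsto.eventually_ge_atTop _).exists

theorem indexAfter_le (n : ℕ) {t : ℝ} {m : ℕ} (hm : elapsedTime α n + t ≤ elapsedTime α m) :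
    indexAfter α n t ≤ m :=
  Nat.sInf_le hm

theorem indexAfter_mono (h : IsNoisyIteration α x y ξ C R) (n : ℕ) : Monotone (indexAfter α n) :=
  fun s t hst => indexAfter_le n (by linarith [h.le_elapsedTime_indexAfter n t])

theorem le_indexAfter (h : IsNoisyIteration α x y ξ C R) (n : ℕ) {t : ℝ} (ht : 0 ≤ t) :
    n ≤ indexAfter α n t :=
  h.elapsedTime_strictMono.le_iff_le.1 (by linarith [h.le_elapsedTime_indexAfter n t])

theorem lt_indexAfter (h : IsNoisyIteration α x y ξ C R) (n : ℕ) {t : ℝ} (ht : 0 < t) :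
    n < indexAfter α n t :=
  h.elapsedTime_strictMono.lt_iff_lt.1 (by linarith [h.le_elapsedTime_indexAfter n t])

theorem indexAfter_zero (h : IsNoisyIteration α x y ξ C R) (n : ℕ) : indexAfter α n 0 = n :=
  le_antisymm (indexAfter_le n (by simp)) (h.le_indexAfter n le_rfl)

theorem indexAfter_tendsto (h : IsNoisyIteration α x y ξ C R) {t : ℝ} (ht : 0 ≤ t) :
    Tendsto (fun n => indexAfter α n t) atTop atTop :=
  tendsto_atTop_mono (fun n => h.le_indexAfter n ht) tendsto_id

/-- The overshoot beyond `t` is at most the last step size, because the preceding index has not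
reached `t`; step sizes vanish. -/
theorem elapsedTime_indexAfter_tendsto (h : IsNoisyIteration α x y ξ C R) {t : ℝ} (ht : 0 ≤ t) :
    Tendsto (fun n => elapsedTime α (indexAfter α n t) - elapsedTime α n) atTop (𝓝 t) := by
  rw [Metric.tendsto_atTop]
  intro ε hε
  obtain ⟨N, hN⟩ := eventually_atTop.1 (h.tendsto_zero.eventually (gt_mem_nhds hε))
  refine ⟨N, fun n hn => ?_⟩
  have h1 := h.le_elapsedTime_indexAfter n t
  rw [Real.dist_eq, abs_lt]
  refine ⟨by linarith, ?_⟩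
  rcases (h.le_indexAfter n ht).eq_or_lt with heq | hlt
  · rw [← heq]
    linarith
  · obtain ⟨m, hm⟩ := Nat.exists_eq_succ_of_ne_zero (Nat.ne_zero_of_lt hlt)
    have h2 : elapsedTime α m < elapsedTime α n + t := by
      by_contra! hcon
      have := indexAfter_le n hcon
      omega
    have h3 := hN m (by omega)
    rw [hm, elapsedTime, Finset.sum_range_succ, ← elapsedTime]
    linarith

theorem sub_eq_sum (h : IsNoisyIteration α x y ξ C R) {a b : ℕ} (hab : a ≤ b) :
    x b - x a = ∑ k ∈ Finset.Ico a b, α k • y k +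
      (∑ k ∈ Finset.range b, α k • ξ k - ∑ k ∈ Finset.range a, α k • ξ k) := by
  induction b, hab using Nat.le_induction with
  | base => simp
  | succ b hb ih =>
    rw [Finset.sum_Ico_succ_top hb, Finset.sum_range_succ, h.step b, add_sub_right_comm, ih,
      smul_add]
    abel

theorem norm_sum_drift_le (h : IsNoisyIteration α x y ξ C R) {a b : ℕ} (hab : a ≤ b) :
    ‖∑ k ∈ Finset.Ico a b, α k • y k‖ ≤ C * (elapsedTime α b - elapsedTime α a) := by
  rw [elapsedTime, elapsedTime, ← Finset.sum_Ico_eq_sub _ hab, Finset.mul_sum]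
  refine norm_sum_le_of_le _ fun k _ => ?_
  rw [norm_smul, Real.norm_of_nonneg (h.pos k).le, mul_comm]
  exact mul_le_mul_of_nonneg_right (h.drift_le k) (h.pos k).le

theorem eventually_noise_lt (h : IsNoisyIteration α x y ξ C R) {ε : ℝ} (hε : 0 < ε) :
    ∀ᶠ n in atTop, ∀ a ≥ n, ∀ b ≥ n,
      ‖∑ k ∈ Finset.range b, α k • ξ k - ∑ k ∈ Finset.range a, α k • ξ k‖ < ε := by
  obtain ⟨c, hc⟩ := h.noise
  obtain ⟨N, hN⟩ := Metric.cauchySeq_iff.1 hc.cauchySeq ε hε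
  filter_upwards [eventually_ge_atTop N] with n hn a ha b hb
  rw [← dist_eq_norm]
  exact hN b (hn.trans hb) a (hn.trans ha)

theorem norm_sub_lt (h : IsNoisyIteration α x y ξ C R) {ε : ℝ} (hε : 0 < ε) :
    ∀ᶠ n in atTop, ∀ a ≥ n, ∀ b ≥ a,
      ‖x b - x a‖ < C * (elapsedTime α b - elapsedTime α a) + ε := by
  filter_upwards [h.eventually_noise_lt hε] with n hn a ha b hb
  rw [h.sub_eq_sum hb]
  exact (norm_add_le _ _).trans_lt
    (add_lt_add_of_le_of_lt (h.norm_sum_drift_le hb) (hn a ha b (ha.trans hb)))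

theorem tendsto_succ_sub (h : IsNoisyIteration α x y ξ C R) :
    Tendsto (fun n => x (n + 1) - x n) atTop (𝓝 0) := by
  obtain ⟨c, hc⟩ := h.noise
  have h1 : Tendsto (fun n => α n • y n) atTop (𝓝 0) := by
    refine squeeze_zero_norm (fun n => ?_) (by simpa using h.tendsto_zero.mul_const C)
    rw [norm_smul, Real.norm_of_nonneg (h.pos n).le]
    exact mul_le_mul_of_nonneg_left (h.drift_le n) (h.pos n).le
  have h2 := ((tendsto_add_atTop_iff_nat 1).2 hc).sub hc
  simpa [h.step, Finset.sum_range_succ] using h1.add h2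

variable {U : Ultrafilter ℕ} {z : ℝ → E}

theorem norm_limit_sub_le (h : IsNoisyIteration α x y ξ C R) (hU : (U : Filter ℕ) ≤ atTop)
    (hz : ∀ t, 0 ≤ t → Tendsto (fun n => x (indexAfter α n t)) U (𝓝 (z t))) {s t : ℝ}
    (hs : 0 ≤ s) (hst : s ≤ t) : ‖z t - z s‖ ≤ C * (t - s) := by
  refine le_of_forall_pos_le_add fun ε hε => ?_
  have ht := hs.trans hst
  have h1 := ((hz t ht).sub (hz s hs)).norm
  have h2 : Tendsto (fun n => C * (elapsedTime α (indexAfter α n t) -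
      elapsedTime α (indexAfter α n s)) + ε) U (𝓝 (C * (t - s) + ε)) := by
    have := ((h.elapsedTime_indexAfter_tendsto ht).sub
      (h.elapsedTime_indexAfter_tendsto hs)).mono_left hU
    simp only [sub_sub_sub_cancel_right] at this
    exact (this.const_mul C).add_const ε
  refine le_of_tendsto_of_tendsto h1 h2 ?_
  filter_upwards [hU (h.norm_sub_lt hε)] with n hn
  exact (hn _ (h.le_indexAfter n hs) _ (h.indexAfter_mono n hst)).le

/-- The iterates stay close to the limiting curve during short times. -/
theorem eventually_dist_lt (h : IsNoisyIteration α x y ξ C R) (hU : (U : Filter ℕ) ≤ atTop)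
    (hz : ∀ t, 0 ≤ t → Tendsto (fun n => x (indexAfter α n t)) U (𝓝 (z t))) {t l δ : ℝ}
    (ht : 0 ≤ t) (hl : 0 ≤ l) (hδ : C * l < δ) :
    ∀ᶠ n in U, ∀ k, indexAfter α n t ≤ k → k ≤ indexAfter α n (t + l) → dist (x k) (z t) < δ := by
  have hC : 0 ≤ C := (norm_nonneg _).trans (h.drift_le 0)
  -- A third of the slack each for time discretisation, noise, and the distance to `z t` at the
  -- starting index.
  set ε := (δ - C * l) / 3 with hε
  have hε0 : 0 < ε := by
    rw [hε]
    linarith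
  have h1 : Tendsto (fun n => C * (elapsedTime α (indexAfter α n (t + l)) -
      elapsedTime α (indexAfter α n t))) U (𝓝 (C * l)) := by
    have := ((h.elapsedTime_indexAfter_tendsto (add_nonneg ht hl)).sub
      (h.elapsedTime_indexAfter_tendsto ht)).mono_left hU
    simp only [sub_sub_sub_cancel_right, add_sub_cancel_left] at this
    exact this.const_mul C
  filter_upwards [h1.eventually (gt_mem_nhds (show C * l < C * l + ε by linarith)),
    (hz t ht).eventually (Metric.ball_mem_nhds _ hε0), hU (h.norm_sub_lt hε0)]
    with n hn1 hn2 hn3 k hk1 hk2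
  have h2 := hn3 _ (h.le_indexAfter n ht) k hk1
  have h3 : C * (elapsedTime α k - elapsedTime α (indexAfter α n t)) ≤
      C * (elapsedTime α (indexAfter α n (t + l)) - elapsedTime α (indexAfter α n t)) := by
    have := h.elapsedTime_strictMono.monotone hk2
    gcongr
  have h4 := dist_triangle (x k) (x (indexAfter α n t)) (z t)
  rw [← dist_eq_norm] at h2
  have h5 : dist (x (indexAfter α n t)) (z t) < ε := hn2
  linarith

/-- The iterates stay in every neighbourhood of a piece of the limiting curve. -/
theorem eventually_forall_mem (h : IsNoisyIteration α x y ξ C R) (hU : (U : Filter ℕ) ≤ atTop)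
    (hz : ∀ t, 0 ≤ t → Tendsto (fun n => x (indexAfter α n t)) U (𝓝 (z t)))
    (hzc : Continuous z) {T : ℝ} (hT : 0 ≤ T) {W : Set E} (hW : IsOpen W)
    (hzW : ∀ t ∈ Icc 0 T, z t ∈ W) :
    ∀ᶠ n in U, ∀ k, n ≤ k → k ≤ indexAfter α n T → x k ∈ W := by
  obtain ⟨η, hη, hsub⟩ := (isCompact_Icc.image hzc).exists_thickening_subset_open hW
    (image_subset_iff.2 hzW)
  -- `[0, T]` is cut into `M + 1` pieces so short (`C * l < η`) that the iterates cannot leave the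
  -- `η`-thickening during one piece.
  obtain ⟨M, hM⟩ := exists_nat_gt (C * T / η)
  have hM1 : (0 : ℝ) < M + 1 := by positivity
  set l := T / (M + 1) with hl
  have hl0 : 0 ≤ l := by positivity
  have hCl : C * l < η := by
    rw [hl, ← mul_div_assoc, div_lt_iff₀ hM1]
    rw [div_lt_iff₀ hη] at hM
    linarith
  have hind : ∀ i : ℕ, i ≤ M + 1 →
      ∀ᶠ n in U, ∀ k, n ≤ k → k ≤ indexAfter α n (i * l) → x k ∈ W := by
    intro i
    induction i with
    | zero =>
      intro _
      have h0 := hz 0 le_rfl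
      simp only [h.indexAfter_zero] at h0
      filter_upwards [h0.eventually (hW.mem_nhds (hzW 0 ⟨le_rfl, hT⟩))] with n hn k hk1 hk2
      rw [Nat.cast_zero, zero_mul, h.indexAfter_zero] at hk2
      rwa [← le_antisymm hk1 hk2]
    | succ i ih =>
      intro hi
      have hil : (0 : ℝ) ≤ i * l := by positivity
      have hiT : i * l ≤ T := by
        have : (i : ℝ) ≤ M + 1 := by exact_mod_cast (Nat.le_succ i).trans hi
        calc i * l ≤ (M + 1) * l := by gcongr
          _ = T := by rw [hl]; field_simp
      filter_upwards [ih (by omega), h.eventually_dist_lt hU hz hil hl0 hCl] with n hn1 hn2 k hk1 hk2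
      rcases le_total k (indexAfter α n (i * l)) with hk | hk
      · exact hn1 k hk1 hk
      · refine hsub (Metric.mem_thickening_iff.2 ⟨z (i * l), ⟨_, ⟨hil, hiT⟩, rfl⟩, hn2 k hk ?_⟩)
        convert hk2 using 2
        push_cast
        ring
  have hlast := hind (M + 1) le_rfl
  have : ((M + 1 : ℕ) : ℝ) * l = T := by
    rw [hl]
    push_cast
    field_simp
  rwa [this] at hlast

/-- Right derivatives of the limiting curve lie in the limiting field. -/
theorem deriv_limit_mem (h : IsNoisyIteration α x y ξ C R) (hU : (U : Filter ℕ) ≤ atTop)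
    (hz : ∀ t, 0 ≤ t → Tendsto (fun n => x (indexAfter α n t)) U (𝓝 (z t)))
    {t : ℝ} (ht : 0 ≤ t) (hd : DifferentiableAt ℝ z t) {A : Set E} (hAcl : IsClosed A)
    (hAconv : Convex ℝ A)
    (hA : ∀ ε > 0, ∃ δ > 0, ∃ K : ℕ, ∀ k ≥ K, dist (x k) (z t) < δ → y k ∈ Metric.cthickening ε A) :
    deriv z t ∈ A := by
  have hC : 0 ≤ C := (norm_nonneg _).trans (h.drift_le 0)
  rw [← hAcl.closure_eq, Metric.closure_eq_iInter_cthickening]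
  refine mem_iInter₂.2 fun ε hε => ?_
  obtain ⟨δ, hδ, K, hK⟩ := hA ε hε
  have hconv := hAconv.cthickening ε
  -- Up to a noise increment that vanishes in the limit, the difference quotient is a limit of
  -- averages of drifts `y k` with weights `α k` over the elapsed time. These are convex
  -- combinations of points of the closed convex thickening.
  have hslope : ∀ᶠ l in 𝓝[>] (0 : ℝ), l⁻¹ • (z (t + l) - z t) ∈ Metric.cthickening ε A := by
    have hsmall : ∀ᶠ l in 𝓝[>] (0 : ℝ), C * l < δ := by
      have : Tendsto (fun l => C * l) (𝓝[>] (0 : ℝ)) (𝓝 0) := by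
        have h0 : ContinuousAt (fun l : ℝ => C * l) 0 := by fun_prop
        simpa [ContinuousAt] using h0.tendsto.mono_left (nhdsWithin_le_nhds (s := Ioi (0 : ℝ)))
      exact this.eventually (gt_mem_nhds hδ)
    filter_upwards [hsmall, self_mem_nhdsWithin] with l hl (hl0 : 0 < l)
    have htl : 0 ≤ t + l := by linarith
    have hτ : Tendsto (fun n => elapsedTime α (indexAfter α n (t + l)) -
        elapsedTime α (indexAfter α n t)) U (𝓝 l) := by
      have := ((h.elapsedTime_indexAfter_tendsto htl).sub
        (h.elapsedTime_indexAfter_tendsto ht)).mono_left hU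
      simpa only [sub_sub_sub_cancel_right, add_sub_cancel_left] using this
    obtain ⟨c, hc⟩ := h.noise
    have hN := ((hc.comp (h.indexAfter_tendsto htl)).sub
      (hc.comp (h.indexAfter_tendsto ht))).mono_left hU
    rw [sub_self] at hN
    have hlim := (hτ.inv₀ hl0.ne').smul (((hz _ htl).sub (hz t ht)).sub hN)
    rw [sub_zero] at hlim
    refine Metric.isClosed_cthickening.mem_of_tendsto hlim ?_
    filter_upwards [hτ.eventually (lt_mem_nhds hl0), hU (eventually_ge_atTop K),
      h.eventually_dist_lt hU hz ht hl0.le hl] with n hn1 hn2 hn3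
    have hab := h.indexAfter_mono n (show t ≤ t + l by linarith)
    simp only [Function.comp_apply]
    rw [h.sub_eq_sum hab, add_sub_cancel_right, Finset.smul_sum]
    simp only [smul_smul]
    refine hconv.sum_mem (fun k _ => ?_) ?_ fun k hk => ?_
    · have := h.pos k
      positivity
    · rw [← Finset.mul_sum, Finset.sum_Ico_eq_sub _ hab]
      exact inv_mul_cancel₀ hn1.ne'
    · rw [Finset.mem_Ico] at hk
      exact hK k ((hn2.trans (h.le_indexAfter n ht)).trans hk.1) (hn3 k hk.1 hk.2.le)
  have hderiv := hd.hasDerivAt.tendsto_slope_zero_right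
  exact Metric.isClosed_cthickening.mem_of_tendsto hderiv hslope

variable [CompleteSpace E] [FiniteDimensional ℝ E]

/-- Along every ultrafilter at infinity the shifted iterates converge to a trajectory of the
limiting field. -/
theorem exists_limit_trajectory (h : IsNoisyIteration α x y ξ C R) (hU : (U : Filter ℕ) ≤ atTop)
    {X : Set E} (hX : IsClosed X) (hxX : ∀ n, x n ∈ X) {G : E → Set E}
    (hGcl : ∀ v, IsClosed (G v)) (hGconv : ∀ v, Convex ℝ (G v))
    (hG : ∀ v, ∀ ε > 0, ∃ δ > 0, ∃ K : ℕ, ∀ k ≥ K, dist (x k) v < δ →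
      y k ∈ Metric.cthickening ε (G v)) :
    ∃ z : ℝ → E, IsTrajectory G X z ∧ Continuous z ∧
      ∀ t, 0 ≤ t → Tendsto (fun n => x (indexAfter α n t)) U (𝓝 (z t)) := by
  have := FiniteDimensional.proper_real E
  have hC : 0 ≤ C := (norm_nonneg _).trans (h.drift_le 0)
  -- An ultrafilter makes the bounded iterates converge for every `t` at once, with no extraction of
  -- subsequences. The `max` extends `z` by a constant to negative times, so it is Lipschitz on all
  -- of `ℝ`.
  have hex : ∀ t : ℝ, ∃ v, Tendsto (fun n => x (indexAfter α n (max t 0))) U (𝓝 v) := fun t => by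
    obtain ⟨v, -, hv⟩ := (isCompact_closedBall (0 : E) R).ultrafilter_le_nhds
      (U.map fun n => x (indexAfter α n (max t 0)))
      (by
        rw [le_principal_iff]
        change ∀ᶠ n in U, x (indexAfter α n (max t 0)) ∈ Metric.closedBall (0 : E) R
        exact Eventually.of_forall fun n => by simpa using h.bounded _)
    exact ⟨v, hv⟩
  choose z hz using hex
  have hz' : ∀ t, 0 ≤ t → Tendsto (fun n => x (indexAfter α n t)) U (𝓝 (z t)) := fun t ht => by
    simpa [max_eq_left ht] using hz t
  have hzmax : ∀ t, z t = z (max t 0) := fun t =>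
    tendsto_nhds_unique (hz t) (by simpa using hz (max t 0))
  have hlip : LipschitzWith C.toNNReal z := by
    refine LipschitzWith.of_dist_le_mul fun t s => ?_
    wlog hst : s ≤ t generalizing s t
    · rw [dist_comm, dist_comm t s]
      exact this s t (le_of_not_ge hst)
    rw [hzmax t, hzmax s, dist_eq_norm, Real.coe_toNNReal _ hC]
    refine (h.norm_limit_sub_le hU hz' (le_max_right _ _) (max_le_max_right 0 hst)).trans ?_
    refine mul_le_mul_of_nonneg_left ?_ hC
    rw [Real.dist_eq]
    exact (le_abs_self _).trans (abs_max_sub_max_le_abs t s 0)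
  refine ⟨z, ⟨hlip.isArc, fun t ht => hX.mem_of_tendsto (hz' t ht)
    (Eventually.of_forall fun n => hxX _), ?_⟩, hlip.continuous, hz'⟩
  filter_upwards [ae_restrict_of_ae hlip.ae_differentiableAt, ae_restrict_mem measurableSet_Ici]
    with t hd ht
  exact h.deriv_limit_mem hU hz' ht hd (hGcl _) (hGconv _) (hG _)

/-- A noisy iteration that follows a field with a weak Lyapunov function converges in value, and
all of its limit points are critical. -/
theorem tendsto_and_limit_points (h : IsNoisyIteration α x y ξ C R)
    {X : Set E} (hX : IsClosed X) (hxX : ∀ n, x n ∈ X) {G : E → Set E}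
    (hGcl : ∀ v, IsClosed (G v)) (hGconv : ∀ v, Convex ℝ (G v))
    (hG : ∀ v, ∀ ε > 0, ∃ δ > 0, ∃ K : ℕ, ∀ k ≥ K, dist (x k) v < δ →
      y k ∈ Metric.cthickening ε (G v))
    {φ : E → ℝ} (hφ : Continuous φ) {Crit : Set E} (hsard : Dense (φ '' Crit)ᶜ)
    (hdescent : ∀ z : ℝ → E, IsTrajectory G X z → z 0 ∉ Crit → ∃ T : ℝ, 0 < T ∧
      φ (z T) < sSup ((fun t => φ (z t)) '' Icc 0 T) ∧
      sSup ((fun t => φ (z t)) '' Icc 0 T) ≤ φ (z 0)) :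
    (∀ v, MapClusterPt v atTop x → v ∈ Crit) ∧ ∃ c, Tendsto (fun n => φ (x n)) atTop (𝓝 c) := by
  have := FiniteDimensional.proper_real E
  have hle_sup : ∀ {z : ℝ → E} {T : ℝ}, Continuous z → ∀ t ∈ Icc 0 T,
      φ (z t) ≤ sSup ((fun t => φ (z t)) '' Icc 0 T) := fun hzc t ht =>
    le_csSup (isCompact_Icc.image (hφ.comp hzc)).bddAbove ⟨t, ht, rfl⟩
  have hbdd : Bornology.IsBounded (φ '' Metric.closedBall 0 R) :=
    ((isCompact_closedBall (0 : E) R).image hφ).isBounded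
  obtain ⟨B, hB⟩ := isBounded_iff_forall_norm_le.1 hbdd
  have hφB : ∀ n, |φ (x n)| ≤ B := fun n =>
    hB _ ⟨x n, by simpa using h.bounded n, rfl⟩
  have hconv : ∃ c, Tendsto (fun n => φ (x n)) atTop (𝓝 c) := by
    refine tendsto_of_no_upcrossings hsard ?_
      (isBoundedUnder_of ⟨B, fun n => (abs_le.1 (hφB n)).2⟩)
      (isBoundedUnder_of ⟨-B, fun n => (abs_le.1 (hφB n)).1⟩)
    rintro a ha b - hab ⟨hlow, hhigh⟩
    -- `n` is the last index up to `m` with `φ ≤ a`, so an upcrossing of `[a, b]` begins there and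
    -- stays above `a` until `m`.
    have hQ : ∃ᶠ n in atTop, φ (x n) ≤ a ∧ ∃ m > n, b < φ (x m) ∧
        ∀ j, n < j → j ≤ m → a < φ (x j) := by
      rw [frequently_atTop]
      intro N
      obtain ⟨n₀, hn₀, hn₀'⟩ := frequently_atTop.1 hlow N
      obtain ⟨m, hm, hm'⟩ := frequently_atTop.1 hhigh n₀
      let n := Nat.findGreatest (fun n => φ (x n) ≤ a) m
      have hn : φ (x n) ≤ a :=
        Nat.findGreatest_spec (P := fun n => φ (x n) ≤ a) hm hn₀'.le
      have hnm : n ≤ m := Nat.findGreatest_le m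
      refine ⟨n, hn₀.trans (Nat.le_findGreatest hm hn₀'.le), hn, m,
        lt_of_le_of_ne hnm fun heq => ?_, hm', fun j hj hjm => ?_⟩
      · rw [heq] at hn
        linarith
      · exact not_le.1 (Nat.findGreatest_is_greatest hj hjm)
    have hne : NeBot (atTop ⊓ 𝓟 {n | φ (x n) ≤ a ∧ ∃ m > n, b < φ (x m) ∧
        ∀ j, n < j → j ≤ m → a < φ (x j)}) := frequently_mem_iff_neBot.1 hQ
    obtain ⟨U, hU⟩ := Ultrafilter.exists_le
      (atTop ⊓ 𝓟 {n | φ (x n) ≤ a ∧ ∃ m > n, b < φ (x m) ∧ ∀ j, n < j → j ≤ m → a < φ (x j)})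
    have hUtop : (U : Filter ℕ) ≤ atTop := hU.trans inf_le_left
    have hUQ : ∀ᶠ n in U, φ (x n) ≤ a ∧ ∃ m > n, b < φ (x m) ∧
        ∀ j, n < j → j ≤ m → a < φ (x j) :=
      le_principal_iff.1 (hU.trans inf_le_right)
    obtain ⟨z, hz, hzc, hzlim⟩ := h.exists_limit_trajectory hUtop hX hxX hGcl hGconv hG
    have hz0 : Tendsto x U (𝓝 (z 0)) := by
      simpa only [h.indexAfter_zero] using hzlim 0 le_rfl
    have hz1 : Tendsto (fun n => x (n + 1)) U (𝓝 (z 0)) := by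
      simpa using (h.tendsto_succ_sub.mono_left hUtop).add hz0
    -- `φ (x n) ≤ a < φ (x (n + 1))`, and both points converge to `z 0`.
    have hza : φ (z 0) = a := by
      refine le_antisymm (le_of_tendsto ((hφ.tendsto _).comp hz0) (hUQ.mono fun n hn => hn.1))
        (ge_of_tendsto ((hφ.tendsto _).comp hz1) (hUQ.mono fun n hn => ?_))
      obtain ⟨-, m, hm, -, hj⟩ := hn
      exact (hj (n + 1) n.lt_succ_self hm).le
    have hcrit : z 0 ∉ Crit := fun hc => ha ⟨z 0, hc, hza⟩
    obtain ⟨T, hT, hT1, hT2⟩ := hdescent z hz hcrit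
    rw [hza] at hT2
    have hev1 := h.eventually_forall_mem hUtop hzlim hzc hT.le (W := {v | φ v < b})
      (isOpen_lt hφ continuous_const) fun t ht => ((hle_sup hzc t ht).trans hT2).trans_lt hab
    have hev2 := ((hφ.tendsto _).comp (hzlim T hT.le)).eventually
      (gt_mem_nhds (hT1.trans_le hT2))
    -- Up to time `T` the iterates stay below `b`, so the upcrossing is unfinished and `φ > a` at
    -- time `T`; yet `φ (z T) < a`.
    obtain ⟨n, ⟨hn1, m, hm, hbm, hj⟩, hn2, hn3⟩ := (hUQ.and (hev1.and hev2)).exists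
    have hlt : indexAfter α n T < m := by
      by_contra! hcon
      exact lt_asymm hbm (hn2 m hm.le hcon)
    exact lt_asymm hn3 (hj _ (h.lt_indexAfter n hT) hlt.le)
  refine ⟨fun v hv => ?_, hconv⟩
  obtain ⟨c, hc⟩ := hconv
  by_contra hcrit
  obtain ⟨U, hU, hUv⟩ := mapClusterPt_iff_ultrafilter.1 hv
  obtain ⟨z, hz, hzc, hzlim⟩ := h.exists_limit_trajectory hU hX hxX hGcl hGconv hG
  have hz0 : z 0 = v := by
    have := hzlim 0 le_rfl
    simp only [h.indexAfter_zero] at this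
    exact tendsto_nhds_unique this hUv
  -- Convergence of the values makes `φ` constant along the limit trajectory, which excludes strict
  -- descent.
  have hφz : ∀ t, 0 ≤ t → φ (z t) = c := fun t ht =>
    tendsto_nhds_unique ((hφ.tendsto _).comp (hzlim t ht))
      ((hc.comp (h.indexAfter_tendsto ht)).mono_left hU)
  obtain ⟨T, hT, hT1, hT2⟩ := hdescent z hz (by rwa [hz0])
  rw [hφz T hT.le] at hT1
  rw [hφz 0 le_rfl] at hT2
  linarith

end IsNoisyIteration

end Dynamics

/-! ### Assembly along almost every sample path. -/

theorem mainTheorem7 {d : ℕ}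
    (f g : EuclideanSpace ℝ (Fin d) → ℝ) (X : Set (EuclideanSpace ℝ (Fin d)))
    (hf : LocallyLipschitz f) (hg : LocallyLipschitz g) (hX : IsClosed X)
    (hgX : BddBelow (g '' X)) (hgrowth : GrowthCondition g)
    -- the sampling space and the stochastic subgradient oracle
    {Ω : Type*} [MeasurableSpace Ω] (P : Measure Ω) [IsProbabilityMeasure P]
    (ζ : EuclideanSpace ℝ (Fin d) → Ω → EuclideanSpace ℝ (Fin d))
    (hζ : IsSubgradientOracle P f X ζ)
    -- the proximal selection
    (T : ℝ → EuclideanSpace ℝ (Fin d) → EuclideanSpace ℝ (Fin d))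
    (hT : IsProxSelection g X T)
    -- the step sizes
    (α : ℕ → ℝ) (hα_pos : ∀ k, 0 < α k) (hα_sum : ¬ Summable α)
    (hα_sq : Summable (fun k => α k ^ 2))
    -- the initial point in `X` and the i.i.d. samples with law `P`
    {S : Type*} [MeasurableSpace S] (μ : Measure S) [IsProbabilityMeasure μ]
    (x₀ : S → EuclideanSpace ℝ (Fin d)) (hx₀ : Measurable x₀) (hx₀X : ∀ᵐ s ∂μ, x₀ s ∈ X)
    (ω : ℕ → S → Ω) (hω : ∀ k, Measurable (ω k)) (hω_law : ∀ k, μ.map (ω k) = P)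
    (hω_indep : iIndepFun ω μ) (hx₀_indep : IndepFun x₀ (fun s k => ω k s) μ)
    -- almost surely the iterates are bounded
    (hbdd : ∀ᵐ s ∂μ, ∃ C : ℝ, ∀ k, ‖proxSubgradIter T ζ α x₀ ω k s‖ ≤ C)
    -- the Lyapunov condition
    (hsard : CompositeWeakSard f g X) (hdescent : CompositeDescent f g X) :
    ∀ᵐ s ∂μ,
      (∀ x : EuclideanSpace ℝ (Fin d),
        MapClusterPt x atTop (fun k => proxSubgradIter T ζ α x₀ ω k s) →
          IsCompositeCritical f g X x) ∧
      ∃ c : ℝ, Tendsto (fun k => f (proxSubgradIter T ζ α x₀ ω k s) +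
        g (proxSubgradIter T ζ α x₀ ω k s)) atTop (𝓝 c) := by
  have hα0 : Tendsto α atTop (𝓝 0) := by
    have h := (Real.continuous_sqrt.tendsto 0).comp hα_sq.tendsto_atTop_zero
    simpa [Function.comp_def, Real.sqrt_sq (hα_pos _).le] using h
  filter_upwards [hx₀X, hbdd, ae_exists_tendsto_noise hζ hT hX hgrowth hα_pos hα_sq hx₀ hω hω_law
    hω_indep hx₀_indep] with s hs₀ hsC hsnoise
  have hsX : ∀ k, proxSubgradIter T ζ α x₀ ω k s ∈ X := fun k => by
    cases k with
    | zero => exact hs₀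
    | succ k => exact hT.mem _ (hα_pos k) _
  obtain ⟨c, hc⟩ := hsnoise hsX hsC
  obtain ⟨R, hR⟩ := hsC
  -- The drift bound may depend on the path: it is taken over the bounded range of the iterates.
  obtain ⟨C, -, hC⟩ := hT.exists_meanDisplacement_bound hgrowth hζ
    (isBounded_iff_forall_norm_le.2 ⟨R, forall_mem_range.2 hR⟩)
  have hiter : IsNoisyIteration α (fun k => proxSubgradIter T ζ α x₀ ω k s)
      (fun k => -meanDisplacement P T ζ (α k) (proxSubgradIter T ζ α x₀ ω k s))
      (fun k => meanDisplacement P T ζ (α k) (proxSubgradIter T ζ α x₀ ω k s) -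
        proxDisplacement T ζ (α k) (proxSubgradIter T ζ α x₀ ω k s) (ω k s)) C R :=
    { pos := hα_pos
      tendsto_zero := hα0
      not_summable := hα_sum
      step := fun k => by
        change T (α k) (_ - α k • ζ _ (ω k s)) = _
        rw [proxStep_eq_sub_smul_displacement T ζ (hα_pos k)]
        module
      drift_le := fun k => by
        rw [norm_neg]
        exact hC _ (mem_range_self k) (hsX k) _ (hα_pos k)
      noise := ⟨c, hc⟩
      bounded := hR }
  refine hiter.tendsto_and_limit_points (φ := fun v => f v + g v)
    (Crit := {v | IsCompositeCritical f g X v}) hX hsX (isClosed_compositeField hf hg X)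
    (convex_compositeField f g X) (fun v ε hε => ?_) (hf.continuous.add hg.continuous) hsard hdescent
  obtain ⟨δ, hδ, K, hK⟩ :=
    hT.exists_neg_meanDisplacement_mem_cthickening hf hg hX hgrowth hζ hα_pos hα0 v hε
  exact ⟨δ, hδ, K, fun k hk hkv => hK k hk _ (hsX k) hkv⟩
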